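/- Let $k\ge 1$ be an integer, let $N=\mathbb C^k$ with coordinates $\sigma_1,\dots,\sigma_k$, let $\partial_h=\partial/\partial\sigma_h$, and let $D_N$ be the sheaf of rings of holomorphic differential operators on $N$; all ideals below are left ideal sheaves of $D_N$ and all modules are sheaves of left $D_N$-modules. With the conventions $\sigma_0=1$ and $\sigma_{k+1}=0$ put $$E=\sum_{h=1}^k\sigma_h\partial_h,\quad U_{-1}=\sum_{h=0}^{k-1}(k-h)\sigma_h\partial_{h+1},\quad U_0=\sum_{h=1}^k h\sigma_h\partial_h,\quad U_1=\sum_{h=1}^k\big(\sigma_1\sigma_h-(h+1)\sigma_{h+1}\big)\partial_h .$$ For $\mu,\lambda\in\mathbb C$ let $\mathcal I_\mu$ be the left ideal of $D_N$ generated by the operators $\partial_i\partial_j-\partial_{i+1}\partial_{j-1}$ ($1\le i\le k-1$, $2\le j\le k$) and $\partial_1\partial_{m-1}+\partial_m(E+\mu)$ ($2\le m\le k$); let $\mathcal N_{\mu,\lambda}=D_N/(\mathcal I_\mu+D_N(U_0-\lambda))$; let $H_\mu$ be the left ideal generated by $\partial_1,\dots,\partial_{k-1}$ and $E+\mu$,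 and let $K_\mu=D_N/H_\mu$. Suppose that $\mu\notin\mathbb Z$ and $k\mu\neq 1$. Then: 1. There is an injective $D_N$-linear map $\chi:K_\mu\to\mathcal N_{\mu,1-k\mu}$ that sends the class of $1$ to the class of $U_{-1}$. 2. Right multiplication by $U_1+\mu\sigma_1$ in $D_N$ induces a $D_N$-linear map $\square(U_1+\mu\sigma_1):\mathcal N_{\mu,1-k\mu}\to\mathcal N_{\mu,-k\mu}$, and this map induces an isomorphism from the quotient $\mathcal N_{\mu,1-k\mu}/\chi(K_\mu)$ onto the submodule $\mathcal N^\sharp_{\mu,-k\mu}$ of $\mathcal N_{\mu,-k\mu}$ defined as the image of $H_\mu$ under the quotient map $D_N\to\mathcal N_{\mu,-k\mu}$. 3. Right multiplication by $U_{-1}$ in $D_N$ induces a $D_N$-linear map $\square U_{-1}:\mathcal N_{\mu,-k\mu}\to\mathcal N_{\mu,1-k\mu}$, and $\mathcal N^\sharp_{\mu,-k\mu}$ is equal to its kernel. -/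

import Mathlib

open CategoryTheory CategoryTheory.Limits TopologicalSpace Opposite Filter Topology

noncomputable section

namespace MuTrace

/-! ### Holomorphic functions and holomorphic differential operators on `ℂ^k` -/

/-- The affine space `N = ℂ^k`. -/
abbrev N (k : ℕ) : TopCat.{0} := TopCat.of (Fin k → ℂ)

/-- The pointwise `ℂ`-algebra structure on germs of functions. -/
instance germAlgebra {α : Type} (l : Filter α) : Algebra ℂ (Germ l ℂ) :=
  Algebra.ofModule
    (fun c x y => Germ.inductionOn₂ x y fun f g => congrArg Germ.ofFun (smul_mul_assoc c f g))
    (fun c x y => Germ.inductionOn₂ x y fun f g => congrArg Germ.ofFun (mul_smul_comm c f g))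

/-- The stalk `𝒪_{N,z}`: the `ℂ`-algebra of germs at `z` of holomorphic functions. -/
def O {k : ℕ} (z : N k) : Subalgebra ℂ (Germ (𝓝 (z : Fin k → ℂ)) ℂ) where
  carrier := {f | ∃ g : (Fin k → ℂ) → ℂ, AnalyticAt ℂ g z ∧ (g : Germ (𝓝 (z : Fin k → ℂ)) ℂ) = f}
  mul_mem' := by
    rintro _ _ ⟨f, hf, rfl⟩ ⟨g, hg, rfl⟩
    exact ⟨f * g, hf.mul hg, rfl⟩
  add_mem' := by
    rintro _ _ ⟨f, hf, rfl⟩ ⟨g, hg, rfl⟩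
    exact ⟨f + g, hf.add hg, rfl⟩
  algebraMap_mem' := fun c =>
    ⟨fun _ => c, analyticAt_const, by
      rw [Algebra.algebraMap_eq_smul_one]
      exact congrArg Germ.ofFun (funext fun _ => (mul_one c).symm)⟩

theorem mem_O {k : ℕ} {z : N k} {f : Germ (𝓝 (z : Fin k → ℂ)) ℂ} :
    f ∈ O z ↔ ∃ g : (Fin k → ℂ) → ℂ, AnalyticAt ℂ g z ∧
      (g : Germ (𝓝 (z : Fin k → ℂ)) ℂ) = f :=
  Iff.rfl

/-- The germ at `z` of a function that is holomorphic near `z`. -/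
def germAt {k : ℕ} (f : (Fin k → ℂ) → ℂ) (z : N k) (hf : AnalyticAt ℂ f z) : O z :=
  ⟨(f : Germ (𝓝 (z : Fin k → ℂ)) ℂ), mem_O.2 ⟨f, hf, rfl⟩⟩

/-- The partial derivative in the `h`-th coordinate, on germs of arbitrary functions. -/
def germPartial {k : ℕ} (h : Fin k) (z : Fin k → ℂ) : Germ (𝓝 z) ℂ → Germ (𝓝 z) ℂ :=
  Germ.map' (fun f w => fderiv ℂ f w (Pi.single h 1)) fun _ _ hfg => by
    filter_upwards [EventuallyEq.fderiv (𝕜 := ℂ) hfg] with w hw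
    rw [hw]

/-- The partial derivative in the `h`-th coordinate, as a `ℂ`-linear endomorphism of `𝒪_{N,z}`. -/
def partialAt {k : ℕ} (h : Fin k) (z : N k) : Module.End ℂ (O z) where
  toFun f := ⟨germPartial h z f.1, by
    obtain ⟨_, hf⟩ := f
    obtain ⟨g, hg, rfl⟩ := mem_O.1 hf
    exact mem_O.2 ⟨fun w => fderiv ℂ g w (Pi.single h 1),
      ((ContinuousLinearMap.apply ℂ ℂ (Pi.single h 1 : Fin k → ℂ)).analyticAt _).comp hg.fderiv,
      rfl⟩⟩
  map_add' := by
    rintro ⟨_, hf⟩ ⟨_, hg⟩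
    obtain ⟨f, hf', rfl⟩ := mem_O.1 hf
    obtain ⟨g, hg', rfl⟩ := mem_O.1 hg
    apply Subtype.ext
    refine Germ.coe_eq.2 ?_
    filter_upwards [hf'.eventually_analyticAt, hg'.eventually_analyticAt] with w hfw hgw
    rw [fderiv_fun_add hfw.differentiableAt hgw.differentiableAt]
    rfl
  map_smul' := by
    rintro c ⟨_, hf⟩
    obtain ⟨f, hf', rfl⟩ := mem_O.1 hf
    apply Subtype.ext
    refine Germ.coe_eq.2 ?_
    filter_upwards [hf'.eventually_analyticAt] with w hfw
    exact congrArg (fun L => L (Pi.single h 1)) (fderiv_const_smul hfw.differentiableAt c)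

/-- Families of operators on the stalks `𝒪_{N,z}`, for `z` in an open set `U`. -/
abbrev OpFamily {k : ℕ} (U : Opens (N k)) : Type := ∀ z : U, Module.End ℂ (O z.1)

/-- Restriction of a family of operators to a smaller open set. -/
def resFamily {k : ℕ} {V U : Opens (N k)} (h : V ≤ U) : OpFamily U →+* OpFamily V where
  toFun P z := P ⟨z.1, h z.2⟩
  map_one' := rfl
  map_mul' _ _ := rfl
  map_zero' := rfl
  map_add' _ _ := rfl

/-- Multiplication by a function `f` that is holomorphic on `U`. -/
def mulFamily {k : ℕ} (U : Opens (N k)) (f : (Fin k → ℂ) → ℂ)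
    (hf : AnalyticOnNhd ℂ f (U : Set (Fin k → ℂ))) : OpFamily U :=
  fun z => LinearMap.mulLeft ℂ (germAt f z.1 (hf z.1 z.2))

/-- The partial derivative in the `h`-th coordinate. -/
def partialFamily {k : ℕ} (U : Opens (N k)) (h : Fin k) : OpFamily U :=
  fun z => partialAt h z.1

/-- The ring of operators on `U` generated by the multiplications by holomorphic functions on `U`
and by the partial derivatives, that is, the finite sums of `f ∂^α` with `f` holomorphic on `U`. -/
def generatedOps {k : ℕ} (U : Opens (N k)) : Subring (OpFamily U) :=
  Subring.closure
    ({P | ∃ f hf, P = mulFamily U f hf} ∪ Set.range (partialFamily U))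

theorem resFamily_mem {k : ℕ} {V U : Opens (N k)} (h : V ≤ U) {P : OpFamily U}
    (hP : P ∈ generatedOps U) : resFamily h P ∈ generatedOps V := by
  have h1 : generatedOps U ≤ (generatedOps V).comap (resFamily h) := by
    refine Subring.closure_le.2 ?_
    rintro _ (⟨f, hf, rfl⟩ | ⟨i, rfl⟩)
    · exact Subring.subset_closure (Or.inl ⟨f, fun z hz => hf z (h hz), rfl⟩)
    · exact Subring.subset_closure (Or.inr ⟨i, rfl⟩)
  exact h1 hP

/-- A family of operators is a holomorphic differential operator if it is, locally, a finite sum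
of `f ∂^α` with `f` holomorphic. -/
def isDiffOp (k : ℕ) : TopCat.LocalPredicate (fun z : N k => Module.End ℂ (O z)) :=
  TopCat.PrelocalPredicate.sheafify
    { pred := fun {U} P => P ∈ generatedOps U
      res := fun i _ hP => resFamily_mem i.le hP }

/-- The ring `D_N(U)` of holomorphic differential operators on `U`. -/
def diffOps {k : ℕ} (U : Opens (N k)) : Subring (OpFamily U) where
  carrier := {P | (isDiffOp k).pred P}
  mul_mem' {P Q} hP hQ z := by
    obtain ⟨V, hV, i, hPV⟩ := hP z
    obtain ⟨W, hW, j, hQW⟩ := hQ z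
    exact ⟨V ⊓ W, ⟨hV, hW⟩, Opens.infLELeft _ _ ≫ i,
      mul_mem (resFamily_mem inf_le_left hPV) (resFamily_mem inf_le_right hQW)⟩
  add_mem' {P Q} hP hQ z := by
    obtain ⟨V, hV, i, hPV⟩ := hP z
    obtain ⟨W, hW, j, hQW⟩ := hQ z
    exact ⟨V ⊓ W, ⟨hV, hW⟩, Opens.infLELeft _ _ ≫ i,
      add_mem (resFamily_mem inf_le_left hPV) (resFamily_mem inf_le_right hQW)⟩
  neg_mem' {P} hP z := by
    obtain ⟨V, hV, i, hPV⟩ := hP z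
    exact ⟨V, hV, i, neg_mem hPV⟩
  one_mem' z := ⟨U, z.2, 𝟙 _, one_mem (generatedOps U)⟩
  zero_mem' z := ⟨U, z.2, 𝟙 _, zero_mem (generatedOps U)⟩

theorem generatedOps_le {k : ℕ} {U : Opens (N k)} {P : OpFamily U} (hP : P ∈ generatedOps U) :
    P ∈ diffOps U :=
  fun z => ⟨U, z.2, 𝟙 _, hP⟩

/-- The type of holomorphic differential operators on `U`. -/
def DiffOp {k : ℕ} (U : Opens (N k)) : Type := diffOps U

instance {k : ℕ} (U : Opens (N k)) : Ring (DiffOp U) := inferInstanceAs (Ring (diffOps U))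

/-- Restriction of differential operators to a smaller open set. -/
def diffRes {k : ℕ} {V U : Opens (N k)} (h : V ≤ U) : DiffOp U →+* DiffOp V where
  toFun P := ⟨resFamily h P.1, (isDiffOp k).res (homOfLE h) P.1 P.2⟩
  map_one' := rfl
  map_mul' _ _ := rfl
  map_zero' := rfl
  map_add' _ _ := rfl

/-- The presheaf of rings `U ↦ D_N(U)`. -/
def diffPresheaf (k : ℕ) : TopCat.Presheaf RingCat.{0} (N k) where
  obj U := RingCat.of (DiffOp U.unop)
  map i := RingCat.ofHom (diffRes i.unop.le)

/-- The sheaf of rings `D_N` of holomorphic differential operators on `N = ℂ^k`. -/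
def D (k : ℕ) : Sheaf (Opens.grothendieckTopology (N k)) RingCat.{0} :=
  ⟨diffPresheaf k, (TopCat.Presheaf.isSheaf_iff_isSheaf_comp (forget RingCat) _).2
    (TopCat.Presheaf.isSheaf_of_iso (F := TopCat.subpresheafToTypes (isDiffOp k).toPrelocalPredicate)
      (NatIso.ofComponents (fun _ => Iso.refl _))
      (TopCat.subpresheafToTypes.isSheaf (isDiffOp k)))⟩

/-- `D_N` as a left module over itself. -/
abbrev DMod (k : ℕ) : SheafOfModules.{0} (D k) := SheafOfModules.unit (D k)

/-- The ring of global sections of `D_N`. -/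
abbrev GlobalOps (k : ℕ) : Type := DiffOp (⊤ : Opens (N k))

/-- Right multiplication by a global section `P` of `D_N`, as a left `D_N`-linear map
`D_N ⟶ D_N`, `Q ↦ Q P`. -/
def rightMul {k : ℕ} (P : GlobalOps k) : DMod k ⟶ DMod k :=
  (DMod k).unitHomEquiv.symm
    (PresheafOfModules.sectionsMk (M := (DMod k).val)
      (fun U => (diffRes (le_top : U.unop ≤ ⊤) P : DiffOp U.unop)) fun _ _ _ => rfl)

theorem rightMul_app {k : ℕ} (P : GlobalOps k) (U : (Opens (N k))ᵒᵖ) (Q : DiffOp U.unop) :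
    (rightMul P).val.app U Q = (Q * diffRes le_top P : DiffOp U.unop) :=
  rfl

/-! ### Left ideals generated by global operators, and the quotients of `D_N` by them -/

theorem span_res {k : ℕ} (S : Set (GlobalOps k)) {W V : Opens (N k)} (h : W ≤ V) {P : DiffOp V}
    (hP : P ∈ Ideal.span (diffRes (le_top : V ≤ ⊤) '' S)) :
    diffRes h P ∈ Ideal.span (diffRes (le_top : W ≤ ⊤) '' S) := by
  have h1 : Ideal.span (diffRes (le_top : V ≤ ⊤) '' S) ≤
      (Ideal.span (diffRes (le_top : W ≤ ⊤) '' S)).comap (diffRes h) := by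
    refine Ideal.span_le.2 ?_
    rintro _ ⟨s, hs, rfl⟩
    exact Ideal.subset_span ⟨s, hs, rfl⟩
  exact h1 hP

/-- The sections of `D_N` over `U` that lie, locally, in the left ideal generated by the global
operators in `S` (`Ideal` means left ideal, as `DiffOp U` is not commutative). -/
def localIdeal {k : ℕ} (S : Set (GlobalOps k)) (U : Opens (N k)) : Ideal (DiffOp U) where
  carrier := {P | ∀ z : U, ∃ (V : Opens (N k)) (_ : z.1 ∈ V) (h : V ≤ U),
    diffRes h P ∈ Ideal.span (diffRes (le_top : V ≤ ⊤) '' S)}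
  add_mem' := by
    intro P Q hP hQ z
    obtain ⟨V, hV, h, hPV⟩ := hP z
    obtain ⟨W, hW, h', hQW⟩ := hQ z
    exact ⟨V ⊓ W, ⟨hV, hW⟩, inf_le_left.trans h,
      add_mem (span_res S inf_le_left hPV) (span_res S inf_le_right hQW)⟩
  zero_mem' := fun z => ⟨U, z.2, le_rfl, by rw [map_zero]; exact zero_mem _⟩
  smul_mem' := fun c P hP z => by
    obtain ⟨V, hV, h, hPV⟩ := hP z
    exact ⟨V, hV, h, by rw [smul_eq_mul, map_mul]; exact Ideal.mul_mem_left _ _ hPV⟩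

theorem localIdeal_res {k : ℕ} (S : Set (GlobalOps k)) {V U : Opens (N k)} (h : V ≤ U)
    {P : DiffOp U} (hP : P ∈ localIdeal S U) : diffRes h P ∈ localIdeal S V := by
  intro z
  obtain ⟨W, hW, h', hPW⟩ := hP ⟨z.1, h z.2⟩
  exact ⟨V ⊓ W, ⟨z.2, hW⟩, inf_le_left, span_res S inf_le_right hPW⟩

/-- The left ideals `localIdeal S U`, as a submodule of the presheaf of modules `D_N`. -/
def idealPresheaf {k : ℕ} (S : Set (GlobalOps k)) :
    PresheafOfModules.Submodule (DMod k).val where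
  obj U := localIdeal S U.unop
  map i _ hP := localIdeal_res S i.unop.le hP

/-- Membership in `localIdeal S U`, as a local condition on families of operators. -/
def isInIdeal {k : ℕ} (S : Set (GlobalOps k)) :
    TopCat.LocalPredicate (fun z : N k => Module.End ℂ (O z)) where
  pred {U} P := ∃ h : (isDiffOp k).pred P, (⟨P, h⟩ : DiffOp U) ∈ localIdeal S U
  res := fun i P hP => ⟨(isDiffOp k).res i P hP.1, localIdeal_res S i.le hP.2⟩
  locality := fun {U} P hP => by
    refine ⟨(isDiffOp k).locality P fun z => ?_, fun z => ?_⟩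
    · obtain ⟨V, hV, i, h, _⟩ := hP z
      exact ⟨V, hV, i, h⟩
    · obtain ⟨V, hV, i, h, hI⟩ := hP z
      obtain ⟨W, hW, h', hPW⟩ := hI ⟨z.1, hV⟩
      exact ⟨W, hW, h'.trans i.le, hPW⟩

theorem idealPresheaf_isSheaf {k : ℕ} (S : Set (GlobalOps k)) :
    Presheaf.IsSheaf (Opens.grothendieckTopology (N k))
      (idealPresheaf S).toPresheafOfModules.presheaf := by
  refine (TopCat.Presheaf.isSheaf_iff_isSheaf_comp (forget AddCommGrpCat) _).2 ?_
  refine TopCat.Presheaf.isSheaf_of_iso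
    (F := TopCat.subpresheafToTypes (isInIdeal S).toPrelocalPredicate) ?_
    (TopCat.subpresheafToTypes.isSheaf (isInIdeal S))
  refine NatIso.ofComponents (fun U => Equiv.toIso
    { toFun := fun P => (⟨⟨P.1, P.2.1⟩, P.2.2⟩ : localIdeal S U.unop)
      invFun := fun P : localIdeal S U.unop => ⟨P.1.1, P.1.2, P.2⟩
      left_inv := fun _ => rfl
      right_inv := fun _ => rfl }) ?_
  intro U V i
  rfl

/-- The left ideal sheaf of `D_N` generated by the global operators in `S`. -/
def idealSheaf {k : ℕ} (S : Set (GlobalOps k)) : SheafOfModules.{0} (D k) :=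
  ⟨(idealPresheaf S).toPresheafOfModules, idealPresheaf_isSheaf S⟩

/-- The inclusion in `D_N` of the left ideal sheaf generated by `S`. -/
def idealι {k : ℕ} (S : Set (GlobalOps k)) : idealSheaf S ⟶ DMod k :=
  ⟨(idealPresheaf S).ι⟩

/-- The quotient, as a sheaf of left `D_N`-modules, of `D_N` by the left ideal generated by `S`. -/
def quotD {k : ℕ} (S : Set (GlobalOps k)) : SheafOfModules.{0} (D k) :=
  cokernel (idealι S)

/-- The quotient map from `D_N` to its quotient by the left ideal generated by `S`. -/
def quotπ {k : ℕ} (S : Set (GlobalOps k)) : DMod k ⟶ quotD S :=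
  cokernel.π (idealι S)

/-- The class, in the quotient of `D_N` by the left ideal generated by `S`, of a global operator. -/
def cls {k : ℕ} (S : Set (GlobalOps k)) (P : GlobalOps k) : (quotD S).val.obj (op ⊤) :=
  (quotπ S).val.app (op ⊤) P

/-! ### The operators of the `μ`-trace system -/

/-- The coordinate function `σ_h` for `1 ≤ h ≤ k`, with `σ_0 = 1` and `σ_h = 0` for `h > k`. -/
def coordFun (k h : ℕ) (z : Fin k → ℂ) : ℂ :=
  if h = 0 then 1 else if hh : h - 1 < k then z ⟨h - 1, hh⟩ else 0

theorem coordFun_analytic (k h : ℕ) (s : Set (Fin k → ℂ)) : AnalyticOnNhd ℂ (coordFun k h) s := by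
  intro z _
  unfold coordFun
  split_ifs with h0 hh
  · exact analyticAt_const
  · exact (ContinuousLinearMap.proj (R := ℂ) (φ := fun _ : Fin k => ℂ) ⟨h - 1, hh⟩).analyticAt z
  · exact analyticAt_const

/-- Multiplication by `σ_h`, with the conventions `σ_0 = 1` and `σ_h = 0` for `h > k`. -/
def σ (k h : ℕ) : GlobalOps k :=
  ⟨mulFamily ⊤ (coordFun k h) (coordFun_analytic k h _),
    generatedOps_le (Subring.subset_closure (Or.inl ⟨_, _, rfl⟩))⟩

/-- The partial derivative `∂_h = ∂/∂σ_h` for `1 ≤ h ≤ k` (and `0` for other `h`, a value which is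
not used). -/
def pd (k h : ℕ) : GlobalOps k :=
  if hh : 1 ≤ h ∧ h ≤ k then
    ⟨partialFamily ⊤ ⟨h - 1, by omega⟩,
      generatedOps_le (Subring.subset_closure (Or.inr ⟨_, rfl⟩))⟩
  else 0

/-- A complex number, as the operator of multiplication by a constant. -/
def const (k : ℕ) (c : ℂ) : GlobalOps k :=
  ⟨mulFamily ⊤ (fun _ => c) (fun _ _ => analyticAt_const),
    generatedOps_le (Subring.subset_closure (Or.inl ⟨_, _, rfl⟩))⟩

/-- `E = ∑_{h=1}^k σ_h ∂_h`. -/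
def E (k : ℕ) : GlobalOps k := ∑ h ∈ Finset.Icc 1 k, σ k h * pd k h

/-- `U_{-1} = ∑_{h=0}^{k-1} (k-h) σ_h ∂_{h+1}`, where `σ_0 = 1`. -/
def Um1 (k : ℕ) : GlobalOps k :=
  ∑ h ∈ Finset.range k, const k ((k : ℂ) - h) * σ k h * pd k (h + 1)

/-- `U_0 = ∑_{h=1}^k h σ_h ∂_h`. -/
def U0 (k : ℕ) : GlobalOps k := ∑ h ∈ Finset.Icc 1 k, const k h * σ k h * pd k h

/-- `U_1 = ∑_{h=1}^k (σ_1 σ_h - (h+1) σ_{h+1}) ∂_h`, where `σ_{k+1} = 0`. -/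
def U1 (k : ℕ) : GlobalOps k :=
  ∑ h ∈ Finset.Icc 1 k, (σ k 1 * σ k h - const k (h + 1) * σ k (h + 1)) * pd k h

/-- `U_1 + μ σ_1`. -/
def U1μ (k : ℕ) (μ : ℂ) : GlobalOps k := U1 k + const k μ * σ k 1

/-- `A_{i,j} = ∂_i ∂_j - ∂_{i+1} ∂_{j-1}`. -/
def A (k i j : ℕ) : GlobalOps k := pd k i * pd k j - pd k (i + 1) * pd k (j - 1)

/-- `T^m_μ = ∂_1 ∂_{m-1} + ∂_m (E + μ)`. -/
def T (k : ℕ) (μ : ℂ) (m : ℕ) : GlobalOps k :=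
  pd k 1 * pd k (m - 1) + pd k m * (E k + const k μ)

/-- The generators of the left ideal `𝓘_μ`: the `A_{i,j}` for `i ∈ [1, k-1]` and `j ∈ [2, k]`, and
the `T^m_μ` for `m ∈ [2, k]`. -/
def genI (k : ℕ) (μ : ℂ) : Set (GlobalOps k) :=
  {P | ∃ i j : ℕ, 1 ≤ i ∧ i + 1 ≤ k ∧ 2 ≤ j ∧ j ≤ k ∧ P = A k i j} ∪
    {P | ∃ m : ℕ, 2 ≤ m ∧ m ≤ k ∧ P = T k μ m}

/-- The generators of the left ideal `𝓙_{μ,lam} = 𝓘_μ + D_N (U_0 - lam)`. -/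
def genJ (k : ℕ) (μ lam : ℂ) : Set (GlobalOps k) :=
  genI k μ ∪ {U0 k - const k lam}

/-- The generators `∂_1, …, ∂_{k-1}, E + μ` of the left ideal `H_μ`. -/
def genH (k : ℕ) (μ : ℂ) : Set (GlobalOps k) :=
  {P | ∃ h : ℕ, 1 ≤ h ∧ h + 1 ≤ k ∧ P = pd k h} ∪ {E k + const k μ}

/-- The `D_N`-module `𝓝_{μ,lam} = D_N / 𝓙_{μ,lam}`. -/
abbrev NMod (k : ℕ) (μ lam : ℂ) : SheafOfModules.{0} (D k) := quotD (genJ k μ lam)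

/-- The `D_N`-module `K_μ = D_N / H_μ`. -/
abbrev K (k : ℕ) (μ : ℂ) : SheafOfModules.{0} (D k) := quotD (genH k μ)

/-- The submodule `𝓝^♯_{μ,-kμ}` of `𝓝_{μ,-kμ}`: the image of the left ideal `H_μ` under the quotient
map `D_N ⟶ 𝓝_{μ,-kμ}`. -/
def Nsharp (k : ℕ) (μ : ℂ) : Subobject (NMod k μ (-(k * μ))) :=
  imageSubobject (idealι (genH k μ) ≫ quotπ (genJ k μ (-(k * μ))))

/-- The map `f` between two quotients of `D_N` by left ideals is induced by the right multiplication
by `P`. (There is at most one such map, and there is one exactly when the right multiplication by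
`P` sends the first ideal into the second.) -/
def IsRightMul {k : ℕ} {S S' : Set (GlobalOps k)} (P : GlobalOps k) (f : quotD S ⟶ quotD S') :
    Prop :=
  quotπ S ≫ f = rightMul P ≫ quotπ S'

end MuTrace

end

noncomputable section

namespace MuTrace

/-! ### Morphisms out of and into quotients of `D_N` by left ideals -/

/-! Write S = 1 + σ_1 t + ⋯ + σ_k t^k, let c_n^x be the coefficient of t^n in S^(-x) (zero for n <
0), and put c_n = c_n^μ. Everything is tested on the functions c_n. Differentiating S^(-x) gives ∂_h
c_n^x = -x c_{n-h}^{x+1}, (E + x) c_n^x = x c_n^{x+1}, U_0 c_n = n c_n, U_{-1} c_n = -(n - 1 + kμ)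
c_{n-1} and (U_1 + μσ_1) c_n = -(n + 1) c_{n+1}.

For μ ∉ ℤ, a finite sum of f ∂^α belongs to 𝓘_μ as soon as it kills every c_n
(`mem_spanR_genI_of_traceValue`): modulo 𝓘_μ it is a combination, over the holomorphic functions, of
1 and the ∂_k^a ∂_r, and these act triangularly on the c_n. Hence P lies in 𝓙_{μ,λ} once some v
satisfies P c_n = (n - λ) v c_n for all n (`mem_spanR_genJ_of_traceValue`), and the inclusions
between ideals become scalar identities in n. The kernel of the multiplication by U_1 + μσ_1 is
found in the same way, dividing by 1 - kμ (`mem_localIdeal_of_mul_U1μ`).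

The kernel of the multiplication by U_{-1} is the harder part (`mem_localIdeal_of_mul_Um1`). If Q
U_{-1} ≡ v (U_0 - 1 + kμ) modulo 𝓘_μ, cancelling n - 1 + kμ shows that t Σ Q(c_n) t^n + Σ v(c_n) t^n
is a single term s t^l. Both series are polynomials times one power S^(-μ-n), so s t^l S^(μ+n) is a
polynomial of bounded degree; as μ + n is not an integer, s = 0. Comparing degrees, the top
coefficient of the numerator of Q vanishes, and this forces Q into H_μ (`mem_genH_of_traceValue`).

`complex_of_localIdeal` converts these statements on sections of D_N into statements on the quotient
sheaves. -/

theorem eq_zero_of_locally {k : ℕ} (Z : SheafOfModules.{0} (D k)) (U : Opens (N k))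
    (x : Z.val.obj (op U))
    (h : ∀ z : U, ∃ (V : Opens (N k)) (_ : z.1 ∈ V) (i : V ≤ U), Z.val.map (homOfLE i).op x = 0) :
    x = 0 := by
  let S : Sieve U :=
    { arrows := fun V i => Z.val.map i.op x = 0
      downward_closed := by
        intro V W i hi j
        have e : Z.val.presheaf.map (j ≫ i).op x =
            Z.val.presheaf.map j.op (Z.val.presheaf.map i.op x) := by
          rw [op_comp, Functor.map_comp]; rfl
        have hi' : Z.val.presheaf.map i.op x = 0 := hi
        have : Z.val.presheaf.map (j ≫ i).op x = 0 := by rw [e, hi', map_zero]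
        exact this }
  have hS : S ∈ Opens.grothendieckTopology (N k) U := by
    intro z hz
    obtain ⟨V, hV, i, hi⟩ := h ⟨z, hz⟩
    exact ⟨V, homOfLE i, hi, hV⟩
  refine Z.isSheaf.isSeparated U S hS x 0 fun V i hi => ?_
  have hi' : Z.val.presheaf.map i.op x = 0 := hi
  have h0 : Z.val.presheaf.map i.op 0 = 0 := map_zero _
  exact hi'.trans h0.symm

/-- Vanishing of a section of `Z` is a local question, and locally a section of the ideal is a left
combination of elements of `S`, while the kernel of `f` on sections is a left ideal. -/
theorem idealι_comp_eq_zero {k : ℕ} (S : Set (GlobalOps k)) {Z : SheafOfModules.{0} (D k)}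
    (f : DMod k ⟶ Z) (h : ∀ s ∈ S, f.val.app (op ⊤) (show (DMod k).val.obj (op ⊤) from s) = 0) :
    idealι S ≫ f = 0 := by
  apply SheafOfModules.hom_ext
  apply PresheafOfModules.hom_ext
  intro U
  ext ⟨P, hP⟩
  change f.val.app U P = 0
  induction U using Opposite.rec with | _ U
  apply eq_zero_of_locally
  intro z
  obtain ⟨V, hV, i, hPV⟩ := hP z
  refine ⟨V, hV, i, ?_⟩
  have nat : ∀ {U V : Opens (N k)} (i : V ≤ U) (Q : (DMod k).val.obj (op U)),
      Z.val.map (homOfLE i).op (f.val.app (op U) Q) =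
        f.val.app (op V) (show (DMod k).val.obj (op V) from diffRes i Q) := by
    intro U V i Q
    exact (PresheafOfModules.naturality_apply f.val (homOfLE i).op Q).symm
  rw [nat]
  let ker : Submodule ((D k).obj.obj (op V)) ((DMod k).val.obj (op V)) :=
    LinearMap.ker (f.val.app (op V)).hom
  have : Ideal.span (diffRes (le_top : V ≤ ⊤) '' S) ≤ (show Ideal (DiffOp V) from ker) := by
    refine Ideal.span_le.2 ?_
    rintro _ ⟨s, hs, rfl⟩
    change f.val.app (op V) (show (DMod k).val.obj (op V) from diffRes le_top s) = 0
    refine (nat (U := ⊤) (V := V) le_top s).symm.trans ?_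
    rw [h s hs]
    exact map_zero (Z.val.presheaf.map _).hom
  exact this hPV

theorem app_eq_zero_of_mem_localIdeal {k : ℕ} {S : Set (GlobalOps k)}
    {Z : SheafOfModules.{0} (D k)} (f : DMod k ⟶ Z)
    (h : ∀ s ∈ S, f.val.app (op ⊤) (show (DMod k).val.obj (op ⊤) from s) = 0)
    {U : Opens (N k)} {P : DiffOp U} (hP : P ∈ localIdeal S U) :
    f.val.app (op U) (show (DMod k).val.obj (op U) from P) = 0 :=
  congrArg (fun g : idealSheaf S ⟶ Z =>
    g.val.app (op U) (show (idealSheaf S).val.obj (op U) from ⟨P, hP⟩)) (idealι_comp_eq_zero S f h)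

theorem exists_lift_idealι {k : ℕ} (S : Set (GlobalOps k)) {X : SheafOfModules.{0} (D k)}
    (f : X ⟶ DMod k) (h : ∀ (U : Opens (N k)) (x : X.val.obj (op U)),
      (show DiffOp U from f.val.app (op U) x) ∈ localIdeal S U) :
    ∃ g, g ≫ idealι S = f := by
  let φ : X.val ⟶ (idealPresheaf S).toPresheafOfModules :=
    { app := fun U => ModuleCat.ofHom
        ((f.val.app U).hom.codRestrict ((idealPresheaf S).obj U) (fun x => h U.unop x))
      naturality := by
        intro U V i
        ext x
        exact Subtype.ext (PresheafOfModules.naturality_apply f.val i x) }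
  exact ⟨⟨φ⟩, rfl⟩

theorem idealι_quotπ {k : ℕ} (S : Set (GlobalOps k)) : idealι S ≫ quotπ S = 0 :=
  cokernel.condition _

instance {k : ℕ} (S : Set (GlobalOps k)) : Epi (quotπ S) := coequalizer.π_epi

theorem quotπ_app_eq_zero {k : ℕ} (S : Set (GlobalOps k)) {U : Opens (N k)} {P : DiffOp U}
    (hP : P ∈ localIdeal S U) :
    (quotπ S).val.app (op U) (show (DMod k).val.obj (op U) from P) = 0 :=
  congrArg (fun f : idealSheaf S ⟶ quotD S =>
    f.val.app (op U) (show (idealSheaf S).val.obj (op U) from ⟨P, hP⟩)) (idealι_quotπ S)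

theorem rightMul_quotπ_app {k : ℕ} (S : Set (GlobalOps k)) (P Q : GlobalOps k) :
    (rightMul P ≫ quotπ S).val.app (op ⊤) (show (DMod k).val.obj (op ⊤) from Q) =
      cls S (Q * P) :=
  rfl

theorem mem_localIdeal_of_mem_span {k : ℕ} {S : Set (GlobalOps k)} {U : Opens (N k)}
    {P : DiffOp U} (hP : P ∈ Ideal.span (diffRes (le_top : U ≤ ⊤) '' S)) : P ∈ localIdeal S U :=
  fun z => ⟨U, z.2, le_rfl, hP⟩

instance {k : ℕ} (S : Set (GlobalOps k)) : Mono (idealι S) where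
  right_cancellation g h e := by
    apply SheafOfModules.hom_ext
    apply PresheafOfModules.hom_ext
    intro U
    ext x
    exact Subtype.ext (congrArg (fun f => f.val.app U x) e)

/-! ### Images and kernels in an abelian category -/

section Subobject

variable {C : Type*} [Category C] [Abelian C]

theorem imageSubobject_comp_of_epi {X Y Z : C} (e : X ⟶ Y) [Epi e] (f : Y ⟶ Z) :
    imageSubobject (e ≫ f) = imageSubobject f := by
  refine le_antisymm (imageSubobject_comp_le e f) ?_
  have : IsIso (Subobject.ofLE _ _ (imageSubobject_comp_le e f)) := isIso_of_mono_of_epi _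
  exact Subobject.le_of_comm (inv (Subobject.ofLE _ _ (imageSubobject_comp_le e f))) (by simp)

/-- In an abelian category the image of `g` is the kernel of its cokernel, so `f` factors through
it. -/
theorem imageSubobject_le_of_comp_cokernel {X Y Z : C} (f : X ⟶ Z) (g : Y ⟶ Z)
    (h : f ≫ cokernel.π g = 0) : imageSubobject f ≤ imageSubobject g := by
  let l : X ⟶ Abelian.image g := kernel.lift _ f h
  have e : imageSubobject g = Subobject.mk (Abelian.image.ι g) := by
    conv_lhs => rw [← Abelian.image.fac g]
    rw [imageSubobject_comp_of_epi, imageSubobject_mono]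
  rw [e]
  exact imageSubobject_le_mk _ _ l (kernel.lift_ι _ _ _)

/-- Sections of a quotient sheaf lift only locally. Pulling `g` back along the epimorphism `ψ`
replaces the lifting of sections: the projection to `P` is again an epimorphism and can be
cancelled. -/
theorem mono_of_epi_comp {X Y Z : C} (ψ : X ⟶ Y) [Epi ψ] (φ : Y ⟶ Z)
    (h : ∀ {T : C} (t : T ⟶ X), t ≫ ψ ≫ φ = 0 → t ≫ ψ = 0) : Mono φ := by
  refine Preadditive.mono_of_cancel_zero φ fun {P} g hg => ?_
  have h1 : pullback.fst ψ g ≫ ψ = 0 := h _ (by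
    rw [← Category.assoc, pullback.condition, Category.assoc, hg, comp_zero])
  rw [pullback.condition] at h1
  exact (cancel_epi (pullback.snd ψ g)).1 (h1.trans comp_zero.symm)

/-- The image of `ι ≫ π'` is the quotient of the source of `G` by the image of `χ`, if `y` induces
`G`. -/
theorem imageSubobject_eq_mk_desc {X I M M' K : C} (ι : I ⟶ X) (π : X ⟶ M) [Epi π] (π' : X ⟶ M')
    (y : X ⟶ X) (χ : K ⟶ M) (G : M ⟶ M') (hG : π ≫ G = y ≫ π') (hχG : χ ≫ G = 0)
    [Mono (cokernel.desc χ G hχG)] (hy : ∃ r, r ≫ ι = y)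
    (hι : ι ≫ π' ≫ cokernel.π (y ≫ π') = 0) :
    imageSubobject (ι ≫ π') = Subobject.mk (cokernel.desc χ G hχG) := by
  rw [← imageSubobject_mono, ← imageSubobject_comp_of_epi (π ≫ cokernel.π χ), Category.assoc,
    cokernel.π_desc, hG]
  refine le_antisymm (imageSubobject_le_of_comp_cokernel _ _ (by rw [Category.assoc, hι])) ?_
  obtain ⟨r, rfl⟩ := hy
  rw [Category.assoc]
  exact imageSubobject_comp_le r _

/-- The kernel of `F` is the image of its pullback to `X`, and that pullback factors through `ι` by
`h`. -/
theorem imageSubobject_eq_kernelSubobject {X I M M' : C} (ι : I ⟶ X) (π : X ⟶ M) [Epi π]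
    (F : M ⟶ M') (h0 : ι ≫ π ≫ F = 0)
    (h : ∀ {T : C} (t : T ⟶ X), t ≫ π ≫ F = 0 → ∃ l, l ≫ ι = t) :
    imageSubobject (ι ≫ π) = kernelSubobject F := by
  apply le_antisymm
  · exact imageSubobject_le _ (factorThruKernelSubobject _ _ (by rw [Category.assoc, h0]))
      (factorThruKernelSubobject_comp_arrow _ _ _)
  · obtain ⟨l, hl⟩ := h (pullback.fst π (kernelSubobject F).arrow) (by
      rw [← Category.assoc, pullback.condition, Category.assoc, kernelSubobject_arrow_comp,
        comp_zero])
    have h1 : kernelSubobject F =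
        imageSubobject (pullback.snd π (kernelSubobject F).arrow ≫ (kernelSubobject F).arrow) := by
      rw [imageSubobject_comp_of_epi, imageSubobject_mono, Subobject.mk_arrow]
    rw [h1, ← pullback.condition, ← hl, Category.assoc]
    exact imageSubobject_comp_le l _

end Subobject

/-- `quotπ S` is the cokernel of the monomorphism `idealι S`, hence `idealι S` is its kernel. -/
theorem mem_localIdeal_of_quotπ {k : ℕ} {S : Set (GlobalOps k)} {X : SheafOfModules.{0} (D k)}
    (f : X ⟶ DMod k) (hf : f ≫ quotπ S = 0) (U : Opens (N k)) (x : X.val.obj (op U)) :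
    (show DiffOp U from f.val.app (op U) x) ∈ localIdeal S U := by
  let g : X ⟶ idealSheaf S := Abelian.monoLift (idealι S) f hf
  have hg : g ≫ idealι S = f := Abelian.monoLift_comp _ _ _
  rw [← hg]
  exact (g.val.app (op U) x).2

theorem exists_lift_of_rightMul {k : ℕ} {S S' : Set (GlobalOps k)} (P : GlobalOps k)
    {T : SheafOfModules.{0} (D k)} (t : T ⟶ DMod k) (ht : t ≫ rightMul P ≫ quotπ S' = 0)
    (h : ∀ (U : Opens (N k)) (Q : DiffOp U), Q * diffRes le_top P ∈ localIdeal S' U →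
      Q ∈ localIdeal S U) : ∃ g, g ≫ idealι S = t :=
  exists_lift_idealι S t fun U x => h U _
    (mem_localIdeal_of_quotπ (t ≫ rightMul P) (by rw [Category.assoc, ht]) U x)

theorem mono_of_rightMul {k : ℕ} {S S' : Set (GlobalOps k)} (P : GlobalOps k)
    {Z : SheafOfModules.{0} (D k)} (ψ : DMod k ⟶ Z) [Epi ψ] (φ : Z ⟶ quotD S')
    (hφ : ψ ≫ φ = rightMul P ≫ quotπ S')
    (hψ : ∀ s ∈ S, ψ.val.app (op ⊤) (show (DMod k).val.obj (op ⊤) from s) = 0)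
    (h : ∀ (U : Opens (N k)) (Q : DiffOp U), Q * diffRes le_top P ∈ localIdeal S' U →
      Q ∈ localIdeal S U) : Mono φ := by
  refine mono_of_epi_comp ψ φ fun {T} t ht => ?_
  obtain ⟨g, rfl⟩ := exists_lift_of_rightMul P t (by rw [← hφ, ht]) h
  rw [Category.assoc, idealι_comp_eq_zero S ψ hψ, comp_zero]

theorem rightMul_comp_rightMul {k : ℕ} (P Q : GlobalOps k) :
    rightMul P ≫ rightMul Q = rightMul (P * Q) := by
  apply SheafOfModules.hom_ext
  apply PresheafOfModules.hom_ext
  intro U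
  ext
  exact mul_assoc (G := DiffOp U.unop) _ _ _

/-- Right multiplication by `W` induces both `χ` and `F`, so `hkerW` serves twice: it makes `χ`
injective and identifies the kernel of `F`. By `hkerY` the kernel of `G` is generated by the class
of `W`, that is, by the image of `χ`. Finally `hY` and `hH` give the two inclusions between the
image of `G` and the image of the ideal generated by `SH`. -/
theorem complex_of_localIdeal {k : ℕ} {SH SJ SJ' : Set (GlobalOps k)} {W Y : GlobalOps k}
    (hHW : ∀ s ∈ SH, s * W ∈ localIdeal SJ ⊤) (hJY : ∀ s ∈ SJ, s * Y ∈ localIdeal SJ' ⊤)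
    (hJW : ∀ s ∈ SJ', s * W ∈ localIdeal SJ ⊤) (hWY : W * Y ∈ localIdeal SJ' ⊤)
    (hkerW : ∀ (U : Opens (N k)) (Q : DiffOp U), Q * diffRes le_top W ∈ localIdeal SJ U →
      Q ∈ localIdeal SH U)
    (hkerY : ∀ (U : Opens (N k)) (Q : DiffOp U), Q * diffRes le_top Y ∈ localIdeal SJ' U →
      Q ∈ localIdeal (SJ ∪ {W}) U)
    (hY : Y ∈ localIdeal SH ⊤) (hH : ∀ s ∈ SH, s ∈ localIdeal (SJ' ∪ {Y}) ⊤) :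
    ∃ (χ : quotD SH ⟶ quotD SJ) (G : quotD SJ ⟶ quotD SJ') (F : quotD SJ' ⟶ quotD SJ),
      Mono χ ∧ χ.val.app (op ⊤) (cls SH 1) = cls SJ W ∧ IsRightMul Y G ∧ IsRightMul W F ∧
      (∃ e : cokernel χ ≅
          (imageSubobject (idealι SH ≫ quotπ SJ') : SheafOfModules.{0} (D k)),
        cokernel.π χ ≫ e.hom ≫ (imageSubobject (idealι SH ≫ quotπ SJ')).arrow = G) ∧
      imageSubobject (idealι SH ≫ quotπ SJ') = kernelSubobject F := by
  have desc : ∀ {S S' : Set (GlobalOps k)} (P : GlobalOps k),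
      (∀ s ∈ S, s * P ∈ localIdeal S' ⊤) → ∃ f : quotD S ⟶ quotD S', IsRightMul P f :=
    fun {S S'} P h => ⟨cokernel.desc (idealι S) (rightMul P ≫ quotπ S')
      (idealι_comp_eq_zero S _ fun s hs => quotπ_app_eq_zero S' (h s hs)), cokernel.π_desc _ _ _⟩
  obtain ⟨χ, hχ⟩ := desc W hHW
  obtain ⟨G, hG⟩ := desc Y hJY
  obtain ⟨F, hF⟩ := desc W hJW
  unfold IsRightMul at hχ hG hF
  have hmono : Mono χ := mono_of_rightMul W (quotπ SH) χ hχ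
    (fun s hs => quotπ_app_eq_zero SH (mem_localIdeal_of_mem_span (Ideal.subset_span ⟨s, hs, rfl⟩)))
    hkerW
  have hχ1 : χ.val.app (op ⊤) (cls SH 1) = cls SJ W := by
    have h1 := congrArg (fun f : DMod k ⟶ quotD SJ =>
      f.val.app (op ⊤) (show (DMod k).val.obj (op ⊤) from (1 : GlobalOps k))) hχ
    refine h1.trans ?_
    rw [rightMul_quotπ_app, one_mul]
  have hχG : χ ≫ G = 0 := by
    rw [← cancel_epi (quotπ SH), reassoc_of% hχ, hG, comp_zero]
    have h1 : idealι {W * Y} ≫ quotπ SJ' = 0 := idealι_comp_eq_zero _ _ (by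
      rintro s rfl
      exact quotπ_app_eq_zero SJ' hWY)
    -- The composite is the right multiplication by `W * Y`, which factors through the ideal
    -- generated by `W * Y`.
    obtain ⟨r, hr⟩ := exists_lift_idealι {W * Y} (rightMul (W * Y)) fun U Q =>
      Ideal.mul_mem_left _ _ (mem_localIdeal_of_mem_span (Ideal.subset_span ⟨W * Y, rfl, rfl⟩))
    rw [← Category.assoc, rightMul_comp_rightMul, ← hr, Category.assoc, h1, comp_zero]
  have hπχ : Epi (cokernel.π χ) := coequalizer.π_epi
  have hψ : Epi (quotπ SJ ≫ cokernel.π χ) := epi_comp _ _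
  have hφ : Mono (cokernel.desc χ G hχG) := by
    refine mono_of_rightMul Y (quotπ SJ ≫ cokernel.π χ) _
      (by rw [Category.assoc, cokernel.π_desc, hG]) ?_ hkerY
    rintro s (hs | rfl)
    · refine (congrArg ((cokernel.π χ).val.app (op ⊤)) (quotπ_app_eq_zero SJ
        (mem_localIdeal_of_mem_span (Ideal.subset_span ⟨s, hs, rfl⟩)))).trans ?_
      exact map_zero ((cokernel.π χ).val.app (op ⊤)).hom
    · refine (congrArg ((cokernel.π χ).val.app (op ⊤)) hχ1).symm.trans ?_
      exact congrArg (fun f : quotD SH ⟶ cokernel χ => f.val.app (op ⊤) (cls SH 1))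
        (cokernel.condition χ)
  have hle := imageSubobject_eq_mk_desc (idealι SH) (quotπ SJ) (quotπ SJ') (rightMul Y) χ G hG hχG
    (exists_lift_idealι SH (rightMul Y) fun U Q =>
      Ideal.mul_mem_left _ _ (localIdeal_res SH le_top hY))
    (idealι_comp_eq_zero SH _ fun s hs => app_eq_zero_of_mem_localIdeal _ ?_ (hH s hs))
  · refine ⟨χ, G, F, hmono, hχ1, hG, hF, ⟨(Subobject.isoOfEqMk _ _ hle).symm, ?_⟩, ?_⟩
    · rw [Iso.symm_hom, Subobject.isoOfEqMk_inv, Subobject.ofMkLE_arrow, cokernel.π_desc]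
    · refine imageSubobject_eq_kernelSubobject (idealι SH) (quotπ SJ') F ?_ ?_
      · rw [hF]
        exact idealι_comp_eq_zero SH _ fun s hs => quotπ_app_eq_zero SJ (hHW s hs)
      · intro T t ht
        rw [hF] at ht
        exact exists_lift_of_rightMul W t ht hkerW
  · rintro s (hs | rfl)
    · refine (congrArg ((cokernel.π (rightMul Y ≫ quotπ SJ')).val.app (op ⊤))
        (quotπ_app_eq_zero SJ'
          (mem_localIdeal_of_mem_span (Ideal.subset_span ⟨s, hs, rfl⟩)))).trans ?_
      exact map_zero ((cokernel.π (rightMul Y ≫ quotπ SJ')).val.app (op ⊤)).hom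
    · have h1 := congrArg (fun f : DMod k ⟶ cokernel (rightMul s ≫ quotπ SJ') =>
        f.val.app (op ⊤) (show (DMod k).val.obj (op ⊤) from (1 : GlobalOps k)))
        (cokernel.condition (rightMul s ≫ quotπ SJ'))
      refine Eq.trans ?_ h1
      refine congrArg ((cokernel.π (rightMul s ≫ quotπ SJ')).val.app (op ⊤)) ?_
      refine Eq.trans ?_ (rightMul_quotπ_app SJ' s 1).symm
      rw [one_mul]
      rfl

/-! ### The coefficients of `(1 + σ_1 t + ⋯ + σ_k t^k)^(-x)` -/

/-- The coefficient of `t^n` in `(σ_1 t + ⋯ + σ_k t^k)^j`. -/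
def powCoeff (k : ℕ) : ℕ → ℤ → (Fin k → ℂ) → ℂ
  | 0, n => fun _ => if n = 0 then 1 else 0
  | j + 1, n => fun w => ∑ h ∈ Finset.Icc 1 k, coordFun k h w * powCoeff k j (n - h) w

/-- The binomial coefficient `(-x).choose j`. -/
def binomCoeff (x : ℂ) : ℕ → ℂ
  | 0 => 1
  | j + 1 => -(x + j) / (j + 1) * binomCoeff x j

/-- The coefficient of `t^n` in `(1 + σ_1 t + ⋯ + σ_k t^k)^(-x)`. -/
def traceCoeff (k : ℕ) (x : ℂ) (n : ℤ) (w : Fin k → ℂ) : ℂ :=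
  ∑ j ∈ Finset.range (n.toNat + 1), binomCoeff x j * powCoeff k j n w

/-- This is the derivative of (1 + y)^(-x), compared coefficientwise. -/
theorem binomCoeff_succ_mul (x : ℂ) (j : ℕ) :
    ((j : ℂ) + 1) * binomCoeff x (j + 1) = -x * binomCoeff (x + 1) j := by
  have hne : ∀ i : ℕ, (i : ℂ) + 1 ≠ 0 := fun i => Nat.cast_add_one_ne_zero i
  induction j with
  | zero => simp [binomCoeff]
  | succ j ih =>
    have h1 : binomCoeff x (j + 2) = -(x + (j + 1 : ℕ)) / ((j + 1 : ℕ) + 1) * binomCoeff x (j + 1) :=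
      rfl
    have h2 : binomCoeff (x + 1) (j + 1) = -(x + 1 + j) / (j + 1) * binomCoeff (x + 1) j := rfl
    rw [h1, h2]
    have h3 := hne j
    have h4 := hne (j + 1)
    have e : binomCoeff x (j + 1) = -x * binomCoeff (x + 1) j / ((j : ℂ) + 1) := by
      rw [← ih]; field_simp
    rw [e]
    field_simp
    push_cast
    ring

/-- Pascal's rule: (1 + y) (1 + y)^(-x-1) = (1 + y)^(-x). -/
theorem binomCoeff_add_one_succ (x : ℂ) (j : ℕ) :
    binomCoeff (x + 1) (j + 1) + binomCoeff (x + 1) j = binomCoeff x (j + 1) := by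
  have h3 : (j : ℂ) + 1 ≠ 0 := Nat.cast_add_one_ne_zero j
  apply mul_left_cancel₀ h3
  rw [binomCoeff_succ_mul]
  have h2 : binomCoeff (x + 1) (j + 1) = -(x + 1 + j) / (j + 1) * binomCoeff (x + 1) j := rfl
  rw [h2]
  field_simp
  ring

theorem binomCoeff_ne_zero {x : ℂ} (hx : ∀ n : ℤ, x ≠ n) (j : ℕ) : binomCoeff x j ≠ 0 := by
  induction j with
  | zero => exact one_ne_zero
  | succ j ih =>
    have h1 : x + j ≠ 0 := fun h => hx (-j) (by push_cast; linear_combination h)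
    exact mul_ne_zero (div_ne_zero (neg_ne_zero.2 h1) (Nat.cast_add_one_ne_zero j)) ih

theorem powCoeff_eq_zero {k j : ℕ} {n : ℤ} (h : n < j) (w : Fin k → ℂ) : powCoeff k j n w = 0 := by
  induction j generalizing n with
  | zero => exact if_neg (by simpa using h.ne)
  | succ j ih =>
    refine Finset.sum_eq_zero fun i hi => ?_
    have := (Finset.mem_Icc.1 hi).1
    rw [ih (by push_cast at h; omega), mul_zero]

/-- Terms with j > n vanish, so any range beyond n may be used; this lets coefficients of different
indices share one range. -/
theorem traceCoeff_eq_sum {k : ℕ} {x : ℂ} {n : ℤ} {M : ℕ} (h : n < M) (w : Fin k → ℂ) :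
    traceCoeff k x n w = ∑ j ∈ Finset.range M, binomCoeff x j * powCoeff k j n w := by
  by_cases hM : n.toNat + 1 ≤ M
  · refine Finset.sum_subset (Finset.range_mono hM) fun j _ hj => ?_
    rw [powCoeff_eq_zero (by simp at hj; omega), mul_zero]
  · have : M = 0 := by omega
    subst this
    rw [Finset.sum_range_zero, traceCoeff]
    exact Finset.sum_eq_zero fun j _ => by
      rw [powCoeff_eq_zero (by push_cast at h; omega), mul_zero]

theorem traceCoeff_of_neg {k : ℕ} {x : ℂ} {n : ℤ} (h : n < 0) (w : Fin k → ℂ) :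
    traceCoeff k x n w = 0 := by
  rw [traceCoeff_eq_sum (M := 0) (by simpa using h), Finset.sum_range_zero]

theorem traceCoeff_zero (k : ℕ) (x : ℂ) (w : Fin k → ℂ) : traceCoeff k x 0 w = 1 := by
  simp [traceCoeff, binomCoeff, powCoeff]

/-- The coefficient of t^n in S · S^(-x-1) = S^(-x). -/
theorem sum_coordFun_mul_traceCoeff (k : ℕ) (x : ℂ) (n : ℤ) (w : Fin k → ℂ) :
    traceCoeff k (x + 1) n w +
      ∑ h ∈ Finset.Icc 1 k, coordFun k h w * traceCoeff k (x + 1) (n - h) w =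
        traceCoeff k x n w := by
  obtain ⟨M, hM⟩ : ∃ M : ℕ, n < M := ⟨n.toNat + 1, by omega⟩
  have h1 : ∀ h ∈ Finset.Icc 1 k, coordFun k h w * traceCoeff k (x + 1) (n - h) w =
      ∑ j ∈ Finset.range M, binomCoeff (x + 1) j * (coordFun k h w * powCoeff k j (n - h) w) := by
    intro h _
    rw [traceCoeff_eq_sum (M := M) (by omega), Finset.mul_sum]
    exact Finset.sum_congr rfl fun j _ => by ring
  rw [Finset.sum_congr rfl h1, Finset.sum_comm, traceCoeff_eq_sum (M := M + 1) (by push_cast; omega),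
    traceCoeff_eq_sum (x := x) (M := M + 1) (by push_cast; omega), Finset.sum_range_succ',
    Finset.sum_range_succ' (fun j => binomCoeff x j * _)]
  have h2 : ∀ j ∈ Finset.range M, binomCoeff x (j + 1) * powCoeff k (j + 1) n w =
      binomCoeff (x + 1) (j + 1) * powCoeff k (j + 1) n w +
        ∑ h ∈ Finset.Icc 1 k, binomCoeff (x + 1) j * (coordFun k h w * powCoeff k j (n - h) w) := by
    intro j _
    rw [← binomCoeff_add_one_succ, add_mul, ← Finset.mul_sum]
    rfl
  rw [Finset.sum_congr rfl h2, Finset.sum_add_distrib]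
  simp only [binomCoeff]
  ring

/-- With y = S - 1, this is the coefficient of t^n in (j + 1) (t y') y^j = t (y^(j+1))'. The
induction writes n = h + (n - h) in the convolution that defines y^(j+2). -/
theorem sum_mul_coordFun_mul_powCoeff (k j : ℕ) (n : ℤ) (w : Fin k → ℂ) :
    (j + 1 : ℂ) * ∑ h ∈ Finset.Icc 1 k, (h : ℂ) * coordFun k h w * powCoeff k j (n - h) w =
      n * powCoeff k (j + 1) n w := by
  induction j generalizing n with
  | zero =>
    simp only [powCoeff, Finset.mul_sum]
    refine Finset.sum_congr rfl fun h _ => ?_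
    by_cases hn : n - h = 0
    · rw [if_pos hn]
      have : n = h := by omega
      subst this
      push_cast
      ring
    · rw [if_neg hn]; simp
  | succ j ih =>
    have h1 : (n : ℂ) * powCoeff k (j + 1 + 1) n w =
        ∑ h ∈ Finset.Icc 1 k, (h : ℂ) * coordFun k h w * powCoeff k (j + 1) (n - h) w +
        ∑ h ∈ Finset.Icc 1 k, coordFun k h w * (((n - h : ℤ) : ℂ) * powCoeff k (j + 1) (n - h) w) := by
      rw [← Finset.sum_add_distrib]
      change (n : ℂ) * ∑ h ∈ Finset.Icc 1 k, coordFun k h w * powCoeff k (j + 1) (n - h) w = _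
      rw [Finset.mul_sum]
      refine Finset.sum_congr rfl fun h _ => ?_
      push_cast
      ring
    have h2 : ∑ h ∈ Finset.Icc 1 k, coordFun k h w *
        (((n - h : ℤ) : ℂ) * powCoeff k (j + 1) (n - h) w) =
        (j + 1) * ∑ i ∈ Finset.Icc 1 k, (i : ℂ) * coordFun k i w * powCoeff k (j + 1) (n - i) w := by
      have h3 : ∀ h ∈ Finset.Icc 1 k, coordFun k h w *
          (((n - h : ℤ) : ℂ) * powCoeff k (j + 1) (n - h) w) =
          ∑ i ∈ Finset.Icc 1 k, (j + 1) * ((i : ℂ) * coordFun k i w *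
            (coordFun k h w * powCoeff k j (n - i - h) w)) := by
        intro h _
        rw [← ih, Finset.mul_sum, Finset.mul_sum]
        refine Finset.sum_congr rfl fun i _ => ?_
        rw [sub_right_comm]
        ring
      rw [Finset.sum_congr rfl h3, Finset.sum_comm, Finset.mul_sum]
      refine Finset.sum_congr rfl fun i _ => ?_
      rw [← Finset.mul_sum, ← Finset.mul_sum]
      rfl
    rw [h1, h2]
    push_cast
    ring

/-- The coefficient of t^n in -x (t S') S^(-x-1) = t (S^(-x))'. -/
theorem sum_mul_coordFun_mul_traceCoeff (k : ℕ) (x : ℂ) (n : ℤ) (w : Fin k → ℂ) :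
    ∑ h ∈ Finset.Icc 1 k, (h : ℂ) * coordFun k h w * (-x * traceCoeff k (x + 1) (n - h) w) =
      n * traceCoeff k x n w := by
  obtain ⟨M, hM⟩ : ∃ M : ℕ, n < M := ⟨n.toNat + 1, by omega⟩
  have h1 : ∀ h ∈ Finset.Icc 1 k,
      (h : ℂ) * coordFun k h w * (-x * traceCoeff k (x + 1) (n - h) w) =
      ∑ j ∈ Finset.range M, binomCoeff x (j + 1) * ((j + 1) *
        ((h : ℂ) * coordFun k h w * powCoeff k j (n - h) w)) := by
    intro h _
    rw [traceCoeff_eq_sum (M := M) (by omega), Finset.mul_sum, Finset.mul_sum]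
    refine Finset.sum_congr rfl fun j _ => ?_
    linear_combination (-(h : ℂ) * coordFun k h w * powCoeff k j (n - h) w) *
      binomCoeff_succ_mul x j
  rw [Finset.sum_congr rfl h1, Finset.sum_comm, traceCoeff_eq_sum (M := M + 1) (by push_cast; omega),
    Finset.sum_range_succ', mul_add, Finset.mul_sum]
  have h2 : (n : ℂ) * (binomCoeff x 0 * powCoeff k 0 n w) = 0 := by
    by_cases hn : n = 0
    · simp [hn]
    · simp [powCoeff, hn]
  rw [h2, add_zero]
  refine Finset.sum_congr rfl fun j _ => ?_
  rw [← Finset.mul_sum, ← Finset.mul_sum, sum_mul_coordFun_mul_powCoeff]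
  ring

theorem powCoeff_analytic (k j : ℕ) (n : ℤ) : AnalyticOnNhd ℂ (powCoeff k j n) Set.univ := by
  induction j generalizing n with
  | zero => exact fun _ _ => analyticAt_const
  | succ j ih =>
    intro z hz
    exact Finset.analyticAt_fun_sum _ fun h _ =>
      (coordFun_analytic k h Set.univ z hz).mul (ih (n - h) z hz)

theorem traceCoeff_analytic (k : ℕ) (x : ℂ) (n : ℤ) (s : Set (Fin k → ℂ)) :
    AnalyticOnNhd ℂ (traceCoeff k x n) s := fun z _ =>
  Finset.analyticAt_fun_sum _ fun j _ => analyticAt_const.mul (powCoeff_analytic k j n z trivial)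

theorem fderiv_coordFun (k : ℕ) {h : ℕ} (hh : h ∈ Finset.Icc 1 k) (i : Fin k) (w : Fin k → ℂ) :
    fderiv ℂ (coordFun k h) w (Pi.single i 1) = if h = i + 1 then 1 else 0 := by
  rw [Finset.mem_Icc] at hh
  have e : coordFun k h = ContinuousLinearMap.proj (R := ℂ) (φ := fun _ : Fin k => ℂ)
      (⟨h - 1, by omega⟩ : Fin k) := by
    funext z
    simp only [coordFun]
    rw [if_neg (by omega), dif_pos (by omega)]
    rfl
  rw [e, ContinuousLinearMap.fderiv]
  simp only [ContinuousLinearMap.proj_apply, Pi.single_apply, Fin.ext_iff]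
  exact if_congr (by omega) rfl rfl

theorem fderiv_powCoeff (k j : ℕ) (n : ℤ) (i : Fin k) (w : Fin k → ℂ) :
    fderiv ℂ (powCoeff k (j + 1) n) w (Pi.single i 1) =
      (j + 1) * powCoeff k j (n - (i + 1 : ℕ)) w := by
  have key : ∀ (j : ℕ) (n : ℤ), fderiv ℂ (powCoeff k (j + 1) n) w (Pi.single i 1) =
      powCoeff k j (n - (i + 1 : ℕ)) w + ∑ h ∈ Finset.Icc 1 k, coordFun k h w *
        fderiv ℂ (powCoeff k j (n - h)) w (Pi.single i 1) := by
    intro j n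
    have hc : ∀ h, DifferentiableAt ℂ (coordFun k h) w := fun h =>
      (coordFun_analytic k h Set.univ w trivial).differentiableAt
    have hp : ∀ n, DifferentiableAt ℂ (powCoeff k j n) w := fun n =>
      (powCoeff_analytic k j n w trivial).differentiableAt
    have e : powCoeff k (j + 1) n =
        fun w => ∑ h ∈ Finset.Icc 1 k, coordFun k h w * powCoeff k j (n - h) w := rfl
    rw [e, fderiv_fun_sum fun h _ => (hc h).fun_mul (hp _), sum_apply]
    have h1 : ∀ h ∈ Finset.Icc 1 k,
        fderiv ℂ (fun w => coordFun k h w * powCoeff k j (n - h) w) w (Pi.single i 1) =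
        (if h = i + 1 then powCoeff k j (n - h) w else 0) + coordFun k h w *
          fderiv ℂ (powCoeff k j (n - h)) w (Pi.single i 1) := by
      intro h hh
      rw [fderiv_fun_mul (hc h) (hp _)]
      simp only [add_apply, smul_apply, smul_eq_mul,
        fderiv_coordFun k hh]
      split_ifs <;> ring
    rw [Finset.sum_congr rfl h1, Finset.sum_add_distrib, Finset.sum_ite_eq',
      if_pos (by simp)]
  induction j generalizing n with
  | zero =>
    rw [key]
    have : ∀ n, powCoeff k 0 n = fun _ => if n = 0 then 1 else 0 := fun _ => rfl
    simp [this]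
  | succ j ih =>
    rw [key]
    simp only [ih]
    have : powCoeff k (j + 1) (n - (i + 1 : ℕ)) w =
      ∑ h ∈ Finset.Icc 1 k, coordFun k h w * powCoeff k j (n - (i + 1 : ℕ) - h) w := rfl
    push_cast
    push_cast at this
    rw [add_mul, one_mul, add_comm, this, Finset.mul_sum, ← Finset.sum_add_distrib,
      ← Finset.sum_add_distrib]
    refine Finset.sum_congr rfl fun h _ => ?_
    rw [sub_right_comm]
    ring

theorem fderiv_traceCoeff (k : ℕ) (x : ℂ) (n : ℤ) (i : Fin k) (w : Fin k → ℂ) :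
    fderiv ℂ (traceCoeff k x n) w (Pi.single i 1) =
      -x * traceCoeff k (x + 1) (n - (i + 1 : ℕ)) w := by
  obtain ⟨M, hM⟩ : ∃ M : ℕ, n < M := ⟨n.toNat + 1, by omega⟩
  have hp : ∀ j, DifferentiableAt ℂ (powCoeff k j n) w := fun j =>
      (powCoeff_analytic k j n w trivial).differentiableAt
  have e : traceCoeff k x n =
      fun w => ∑ j ∈ Finset.range (M + 1), binomCoeff x j * powCoeff k j n w :=
    funext fun w => traceCoeff_eq_sum (by push_cast; omega) w
  rw [e, fderiv_fun_sum fun j _ => (hp j).const_mul _, sum_apply]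
  simp only [fderiv_const_mul (hp _), smul_apply, smul_eq_mul]
  rw [Finset.sum_range_succ']
  simp only [fderiv_powCoeff]
  have : powCoeff k 0 n = fun _ => if n = 0 then 1 else 0 := rfl
  rw [traceCoeff_eq_sum (M := M) (by push_cast; omega), this, Finset.mul_sum]
  simp only [fderiv_fun_const, Pi.zero_apply, zero_apply, mul_zero, add_zero]
  refine Finset.sum_congr rfl fun j _ => ?_
  linear_combination (powCoeff k j (n - (i + 1 : ℕ)) w) * binomCoeff_succ_mul x j

/-- At the point σ = (1, 0, …, 0) the series S is 1 + t, so the powers of S - 1 are the powers of t.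
-/
theorem powCoeff_single (k j : ℕ) (hk : 0 < k) (n : ℤ) :
    powCoeff k j n (Pi.single ⟨0, hk⟩ 1) = if n = j then 1 else 0 := by
  induction j generalizing n with
  | zero => simp [powCoeff]
  | succ j ih =>
    have h1 : ∀ h ∈ Finset.Icc 1 k, coordFun k h (Pi.single ⟨0, hk⟩ 1) *
        powCoeff k j (n - h) (Pi.single ⟨0, hk⟩ 1) =
        if h = 1 then (if n = j + 1 then 1 else 0) else 0 := by
      intro h hh
      rw [Finset.mem_Icc] at hh
      rw [ih]
      simp only [coordFun]
      rw [if_neg (by omega), dif_pos (by omega), Pi.single_apply]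
      simp only [Fin.ext_iff]
      by_cases h1 : h = 1
      · subst h1
        simp [sub_eq_iff_eq_add]
      · rw [if_neg (by omega), if_neg h1, zero_mul]
    change ∑ h ∈ Finset.Icc 1 k, _ = _
    rw [Finset.sum_congr rfl h1, Finset.sum_ite_eq', if_pos (by simp; omega)]
    simp

theorem traceCoeff_single (k : ℕ) (hk : 0 < k) (x : ℂ) (n : ℕ) :
    traceCoeff k x n (Pi.single ⟨0, hk⟩ 1) = binomCoeff x n := by
  simp only [traceCoeff, powCoeff_single]
  simp

/-- The coefficients of nonintegral powers do not vanish on any nonempty open set. -/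
theorem not_eventually_traceCoeff_eq_zero {k : ℕ} (hk : 0 < k) {x : ℂ} (hx : ∀ n : ℤ, x ≠ n)
    (n : ℕ) (w : Fin k → ℂ) : ¬ ∀ᶠ z in 𝓝 w, traceCoeff k x n z = 0 := by
  intro h
  -- By the identity theorem on ℂ^k, local vanishing would give vanishing at (1, 0, …, 0), where the
  -- value is a binomial coefficient, nonzero for nonintegral exponent.
  have h1 := (traceCoeff_analytic k x n Set.univ).eqOn_zero_of_preconnected_of_eventuallyEq_zero
    isPreconnected_univ (Set.mem_univ w) h
  have h2 := h1 (Set.mem_univ (Pi.single ⟨0, hk⟩ 1))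
  rw [traceCoeff_single] at h2
  exact binomCoeff_ne_zero hx n h2

/-! ### Holomorphic functions, their germs and the action of differential operators on germs -/

/-- The algebra of functions that are holomorphic on `V`. -/
def holo {k : ℕ} (V : Opens (N k)) : Subalgebra ℂ ((Fin k → ℂ) → ℂ) where
  carrier := {f | AnalyticOnNhd ℂ f (V : Set (Fin k → ℂ))}
  mul_mem' hf hg := hf.mul hg
  add_mem' hf hg := hf.add hg
  algebraMap_mem' _ := fun _ _ => analyticAt_const

/-- The germ of a holomorphic function. -/
def toGerm {k : ℕ} {V : Opens (N k)} (z : V) : holo V →ₐ[ℂ] O z.1 where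
  toFun f := germAt f.1 z.1 (f.2 z.1 z.2)
  map_one' := rfl
  map_mul' _ _ := rfl
  map_zero' := rfl
  map_add' _ _ := rfl
  commutes' c := by
    apply Subtype.ext
    change ((fun _ => c : (Fin k → ℂ) → ℂ) : Germ (𝓝 (z.1 : Fin k → ℂ)) ℂ) = _
    rw [Algebra.algebraMap_eq_smul_one]
    exact congrArg Germ.ofFun (funext fun _ => (mul_one c).symm)

/-- The value of a germ. -/
def valueAt {k : ℕ} (z : N k) : O z →ₐ[ℂ] ℂ where
  toRingHom := (Germ.valueRingHom : Germ (𝓝 (z : Fin k → ℂ)) ℂ →+* ℂ).comp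
    (O z).toSubring.subtype
  commutes' c := mul_one c

theorem valueAt_toGerm {k : ℕ} {V : Opens (N k)} (z : V) (f : holo V) :
    valueAt z.1 (toGerm z f) = f.1 z.1 := rfl

/-- The action of a differential operator on the germs at a point. -/
def opAt {k : ℕ} {V : Opens (N k)} (z : V) : DiffOp V →+* Module.End ℂ (O z.1) :=
  (Pi.evalRingHom (fun z : V => Module.End ℂ (O z.1)) z).comp (diffOps V).subtype

theorem diffOp_ext {k : ℕ} {V : Opens (N k)} {P Q : DiffOp V} (h : ∀ z u, opAt z P u = opAt z Q u) :
    P = Q :=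
  Subtype.ext (funext fun z => LinearMap.ext (h z))

/-- Multiplication by a holomorphic function. -/
def mulHom {k : ℕ} (V : Opens (N k)) : holo V →+* DiffOp V where
  toFun f := ⟨mulFamily V f.1 f.2, generatedOps_le (Subring.subset_closure (Or.inl ⟨_, _, rfl⟩))⟩
  map_one' := diffOp_ext fun _ u => one_mul u
  map_mul' f g := diffOp_ext fun z u => mul_assoc (toGerm z f) (toGerm z g) u
  map_zero' := diffOp_ext fun _ u => zero_mul u
  map_add' f g := diffOp_ext fun z u => add_mul (toGerm z f) (toGerm z g) u

theorem opAt_mulHom {k : ℕ} {V : Opens (N k)} (z : V) (f : holo V) (u : O z.1) :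
    opAt z (mulHom V f) u = toGerm z f * u := rfl

/-- The partial derivative in the `i`-th coordinate. -/
def dd {k : ℕ} (V : Opens (N k)) (i : Fin k) : DiffOp V :=
  ⟨partialFamily V i, generatedOps_le (Subring.subset_closure (Or.inr ⟨_, rfl⟩))⟩

/-- The partial derivative of a holomorphic function. -/
def holoDeriv {k : ℕ} {V : Opens (N k)} (i : Fin k) (f : holo V) : holo V :=
  ⟨fun w => fderiv ℂ f.1 w (Pi.single i 1), fun z hz =>
    ((ContinuousLinearMap.apply ℂ ℂ (Pi.single i 1 : Fin k → ℂ)).analyticAt _).comp (f.2 z hz).fderiv⟩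

theorem opAt_dd_toGerm {k : ℕ} {V : Opens (N k)} (z : V) (i : Fin k) (f : holo V) :
    opAt z (dd V i) (toGerm z f) = toGerm z (holoDeriv i f) := rfl

theorem dd_mul_mulHom {k : ℕ} (V : Opens (N k)) (i : Fin k) (f : holo V) :
    dd V i * mulHom V f = mulHom V f * dd V i + mulHom V (holoDeriv i f) := by
  refine diffOp_ext fun z u => ?_
  obtain ⟨u, hu⟩ := u
  obtain ⟨g, hg, rfl⟩ := mem_O.1 hu
  apply Subtype.ext
  refine Germ.coe_eq.2 ?_
  filter_upwards [(f.2 z.1 z.2).eventually_analyticAt, hg.eventually_analyticAt] with w hfw hgw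
  have := fderiv_mul hfw.differentiableAt hgw.differentiableAt
  refine (congrArg (fun L => L (Pi.single i 1)) this).trans ?_
  change f.1 w * fderiv ℂ g w (Pi.single i 1) + g w * fderiv ℂ f.1 w (Pi.single i 1) =
    f.1 w * fderiv ℂ g w (Pi.single i 1) + fderiv ℂ f.1 w (Pi.single i 1) * g w
  ring

theorem dd_comm {k : ℕ} (V : Opens (N k)) (i j : Fin k) : Commute (dd V i) (dd V j) := by
  refine diffOp_ext fun z u => ?_
  obtain ⟨u, hu⟩ := u
  obtain ⟨g, hg, rfl⟩ := mem_O.1 hu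
  apply Subtype.ext
  refine Germ.coe_eq.2 ?_
  filter_upwards [hg.eventually_analyticAt] with w hgw
  have h2 : ∀ i j : Fin k, fderiv ℂ (fun w => fderiv ℂ g w (Pi.single j 1)) w (Pi.single i 1) =
      fderiv ℂ (fderiv ℂ g) w (Pi.single i 1) (Pi.single j 1) := by
    intro i j
    rw [fderiv_clm_apply hgw.fderiv.differentiableAt (differentiableAt_const _)]
    simp
  change fderiv ℂ (fun w => fderiv ℂ g w (Pi.single j 1)) w (Pi.single i 1) =
    fderiv ℂ (fun w => fderiv ℂ g w (Pi.single i 1)) w (Pi.single j 1)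
  rw [h2, h2]
  exact (hgw.contDiffAt (n := 2)).isSymmSndFDerivAt (by simp) _ _

/-- The coordinate functions. -/
def coord {k : ℕ} (V : Opens (N k)) (h : ℕ) : holo V := ⟨coordFun k h, coordFun_analytic k h _⟩

/-- The coefficient of `t^n` in `(1 + σ_1 t + ⋯ + σ_k t^k)^(-x)`. -/
def traceFun {k : ℕ} (V : Opens (N k)) (x : ℂ) (n : ℤ) : holo V :=
  ⟨traceCoeff k x n, traceCoeff_analytic k x n _⟩

/-- The subring of `D_N(V)` generated by the holomorphic functions and the partial derivatives. -/
def genSub {k : ℕ} (V : Opens (N k)) : Subring (DiffOp V) :=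
  (generatedOps V).comap (diffOps V).subtype

theorem mulHom_mem {k : ℕ} (V : Opens (N k)) (f : holo V) : mulHom V f ∈ genSub V :=
  Subring.subset_closure (Or.inl ⟨f.1, f.2, rfl⟩)

theorem dd_mem {k : ℕ} (V : Opens (N k)) (i : Fin k) : dd V i ∈ genSub V :=
  Subring.subset_closure (Or.inr ⟨_, rfl⟩)

theorem diffRes_mem_genSub {k : ℕ} {V W : Opens (N k)} (h : W ≤ V) {P : DiffOp V}
    (hP : P ∈ genSub V) : diffRes h P ∈ genSub W :=
  resFamily_mem h hP

/-- An element of `generatedOps V`, as a differential operator. -/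
def ofGenerated {k : ℕ} {V : Opens (N k)} {Q : OpFamily V} (hQ : Q ∈ generatedOps V) : DiffOp V :=
  ⟨Q, generatedOps_le hQ⟩

theorem genSub_induction {k : ℕ} {V : Opens (N k)} {p : DiffOp V → Prop}
    (hmul : ∀ f Q, p Q → p (mulHom V f * Q)) (hdd : ∀ i Q, p Q → p (dd V i * Q))
    (hadd : ∀ P Q, p P → p Q → p (P + Q)) (hneg : ∀ P, p P → p (-P)) (h1 : p 1)
    {P : DiffOp V} (hP : P ∈ genSub V) : p P := by
  have h0 : p 0 := by simpa using hadd 1 (-1) h1 (hneg 1 h1)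
  -- Keeping an arbitrary right factor `R` turns the case of a product into an iteration.
  have key : ∀ (Q : OpFamily V) (hQ : Q ∈ generatedOps V), ∀ R : DiffOp V, p R →
      p (ofGenerated hQ * R) := by
    intro Q hQ
    induction hQ using Subring.closure_induction with
    | mem x hx =>
      obtain (⟨f, hf, rfl⟩ | ⟨i, rfl⟩) := hx
      · exact hmul ⟨f, hf⟩
      · exact hdd i
    | zero => exact fun R _ => by convert h0 using 1; exact zero_mul R
    | one => exact fun R hR => by convert hR using 1; exact one_mul R
    | add x y hx hy ihx ihy =>
      exact fun R hR => by
        convert hadd _ _ (ihx R hR) (ihy R hR) using 1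
        exact add_mul (ofGenerated hx) (ofGenerated hy) R
    | neg x hx ih =>
      exact fun R hR => by
        convert hneg _ (ih R hR) using 1
        exact neg_mul (ofGenerated hx) R
    | mul x y hx hy ihx ihy =>
      exact fun R hR => by
        convert ihx _ (ihy R hR) using 1
        exact mul_assoc (ofGenerated hx) (ofGenerated hy) R
  have h := key P.1 hP 1 h1
  rwa [mul_one] at h

/-- The partial derivative `∂_h` over `V`. -/
abbrev pdR {k : ℕ} (V : Opens (N k)) (h : ℕ) : DiffOp V := diffRes le_top (pd k h)

theorem pdR_eq_dd {k : ℕ} (V : Opens (N k)) {h : ℕ} (h1 : 1 ≤ h) (h2 : h ≤ k) :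
    pdR V h = dd V ⟨h - 1, by omega⟩ := by
  rw [pdR, show pd k h = dd ⊤ ⟨h - 1, by omega⟩ from dif_pos ⟨h1, h2⟩]
  rfl

theorem pdR_eq_zero {k : ℕ} (V : Opens (N k)) {h : ℕ} (hh : ¬(1 ≤ h ∧ h ≤ k)) : pdR V h = 0 := by
  rw [pdR, show pd k h = 0 from dif_neg hh, map_zero]

theorem dd_eq_pdR {k : ℕ} (V : Opens (N k)) (i : Fin k) : dd V i = pdR V (i + 1) := by
  rw [pdR_eq_dd V (by omega) (by omega)]
  rfl

theorem pdR_comm {k : ℕ} (V : Opens (N k)) (i j : ℕ) : Commute (pdR V i) (pdR V j) := by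
  by_cases hi : 1 ≤ i ∧ i ≤ k
  · by_cases hj : 1 ≤ j ∧ j ≤ k
    · rw [pdR_eq_dd V hi.1 hi.2, pdR_eq_dd V hj.1 hj.2]
      exact dd_comm V _ _
    · rw [pdR_eq_zero V hj]
      exact Commute.zero_right _
  · rw [pdR_eq_zero V hi]
    exact Commute.zero_left _

theorem pdR_mem {k : ℕ} (V : Opens (N k)) (h : ℕ) : pdR V h ∈ genSub V := by
  by_cases hh : 1 ≤ h ∧ h ≤ k
  · rw [pdR_eq_dd V hh.1 hh.2]
    exact dd_mem V _
  · rw [pdR_eq_zero V hh]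
    exact zero_mem _

theorem diffRes_σ {k : ℕ} (V : Opens (N k)) (h : ℕ) :
    diffRes le_top (σ k h) = mulHom V (coord V h) := rfl

theorem diffRes_const {k : ℕ} (V : Opens (N k)) (c : ℂ) :
    diffRes le_top (const k c) = mulHom V (algebraMap ℂ (holo V) c) := rfl

theorem holoDeriv_coord {k : ℕ} (V : Opens (N k)) {h : ℕ} (hh : h ∈ Finset.Icc 1 k) (i : Fin k) :
    holoDeriv i (coord V h) = if h = i + 1 then 1 else 0 := by
  apply Subtype.ext
  funext w
  refine (fderiv_coordFun k hh i w).trans ?_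
  split_ifs <;> rfl

theorem pdR_mul_coord {k : ℕ} (V : Opens (N k)) {i h : ℕ} (hi : i ∈ Finset.Icc 1 k)
    (hh : h ∈ Finset.Icc 1 k) :
    pdR V i * mulHom V (coord V h) = mulHom V (coord V h) * pdR V i + if h = i then 1 else 0 := by
  rw [Finset.mem_Icc] at hi
  rw [pdR_eq_dd V hi.1 hi.2, dd_mul_mulHom, holoDeriv_coord V hh]
  congr 1
  simp only [Nat.sub_add_cancel hi.1]
  split_ifs <;> simp

/-- The Euler operator over `V`. -/
abbrev eulerR {k : ℕ} (V : Opens (N k)) : DiffOp V := diffRes le_top (E k)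

theorem eulerR_eq {k : ℕ} (V : Opens (N k)) :
    eulerR V = ∑ h ∈ Finset.Icc 1 k, mulHom V (coord V h) * pdR V h := by
  rw [eulerR, E, map_sum]
  rfl

theorem pdR_mul_eulerR {k : ℕ} (V : Opens (N k)) {i : ℕ} (hi : i ∈ Finset.Icc 1 k) :
    pdR V i * eulerR V = (eulerR V + 1) * pdR V i := by
  rw [eulerR_eq, Finset.mul_sum, add_mul, Finset.sum_mul, one_mul]
  have h1 : ∀ h ∈ Finset.Icc 1 k, pdR V i * (mulHom V (coord V h) * pdR V h) =
      mulHom V (coord V h) * pdR V h * pdR V i + if h = i then pdR V i else 0 := by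
    intro h hh
    rw [← mul_assoc, pdR_mul_coord V hi hh, add_mul, mul_assoc, (pdR_comm V i h).eq, ← mul_assoc]
    congr 1
    split_ifs with e
    · rw [one_mul, e]
    · rw [zero_mul]
  rw [Finset.sum_congr rfl h1, Finset.sum_add_distrib, Finset.sum_ite_eq', if_pos hi]

theorem pdR_pow_mul_eulerR {k : ℕ} (V : Opens (N k)) {i : ℕ} (hi : i ∈ Finset.Icc 1 k) (a : ℕ) :
    pdR V i ^ a * eulerR V = (eulerR V + a) * pdR V i ^ a := by
  induction a with
  | zero => simp
  | succ a ih =>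
    rw [pow_succ, mul_assoc, pdR_mul_eulerR V hi, ← mul_assoc, mul_add, ih, mul_one, ← pow_succ,
      add_mul, mul_assoc, ← pow_succ]
    push_cast
    noncomm_ring

/-! ### The action on the coefficients -/

theorem holo_ext {k : ℕ} {V : Opens (N k)} {f g : holo V} (h : ∀ w, f.1 w = g.1 w) : f = g :=
  Subtype.ext (funext h)

theorem holo_sum_apply {k : ℕ} {V : Opens (N k)} {ι : Type*} (s : Finset ι) (f : ι → holo V)
    (w : Fin k → ℂ) : (∑ i ∈ s, f i).1 w = ∑ i ∈ s, (f i).1 w := by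
  rw [AddSubmonoidClass.coe_finsetSum, Finset.sum_apply]

theorem opAt_pdR {k : ℕ} {V : Opens (N k)} (z : V) {h : ℕ} (hh : h ∈ Finset.Icc 1 k) (x : ℂ)
    (n : ℤ) : opAt z (pdR V h) (toGerm z (traceFun V x n)) =
      (-x) • toGerm z (traceFun V (x + 1) (n - h)) := by
  rw [Finset.mem_Icc] at hh
  rw [pdR_eq_dd V hh.1 hh.2, opAt_dd_toGerm, ← map_smul]
  congr 1
  refine holo_ext fun w => (fderiv_traceCoeff k x n _ w).trans ?_
  simp only [Nat.sub_add_cancel hh.1]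
  rfl

theorem sum_range_succ_eq_add_sum_Icc {M : Type*} [AddCommMonoid M] (k : ℕ) (f : ℕ → M) :
    ∑ i ∈ Finset.range (k + 1), f i = f 0 + ∑ i ∈ Finset.Icc 1 k, f i := by
  rw [Finset.range_eq_Ico, Finset.sum_eq_sum_Ico_succ_bot k.succ_pos]
  rfl

theorem sum_Icc_succ_add {M : Type*} [AddCommMonoid M] (k : ℕ) (f : ℕ → M) :
    ∑ i ∈ Finset.Icc 1 k, f (i + 1) + f 1 = ∑ i ∈ Finset.Icc 1 k, f i + f (k + 1) := by
  induction k with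
  | zero => simp
  | succ k ih =>
    rw [Finset.sum_Icc_succ_top (by omega), Finset.sum_Icc_succ_top (by omega), add_right_comm, ih]

theorem coordFun_zero (k : ℕ) (w : Fin k → ℂ) : coordFun k 0 w = 1 := rfl

theorem coordFun_of_lt {k h : ℕ} (hh : k < h) (w : Fin k → ℂ) : coordFun k h w = 0 := by
  rw [coordFun, if_neg (by omega), dif_neg (by omega)]

theorem opAt_mulHom_mul_pdR {k : ℕ} {V : Opens (N k)} (z : V) (f : holo V) {h : ℕ}
    (hh : h ∈ Finset.Icc 1 k) (x : ℂ) (n : ℤ) :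
    opAt z (mulHom V f * pdR V h) (toGerm z (traceFun V x n)) =
      toGerm z (f * (-x) • traceFun V (x + 1) (n - h)) := by
  rw [map_mul, Module.End.mul_apply, opAt_pdR z hh, opAt_mulHom, map_mul, map_smul]

theorem opAt_sum_mulHom_mul_pdR {k : ℕ} {V : Opens (N k)} (z : V) (s : Finset ℕ) (f : ℕ → holo V)
    (g : ℕ → ℕ) (hg : ∀ h ∈ s, g h ∈ Finset.Icc 1 k) (x : ℂ) (n : ℤ) :
    opAt z (∑ h ∈ s, mulHom V (f h) * pdR V (g h)) (toGerm z (traceFun V x n)) =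
      toGerm z (∑ h ∈ s, f h * (-x) • traceFun V (x + 1) (n - g h)) := by
  rw [map_sum, LinearMap.sum_apply, map_sum]
  exact Finset.sum_congr rfl fun h hh => opAt_mulHom_mul_pdR z _ (hg h hh) x n

/-- The operator `U_0` over `V`. -/
abbrev U0R {k : ℕ} (V : Opens (N k)) : DiffOp V := diffRes le_top (U0 k)

/-- The operator `U_{-1}` over `V`. -/
abbrev Um1R {k : ℕ} (V : Opens (N k)) : DiffOp V := diffRes le_top (Um1 k)

/-- The operator `U_1 + μ σ_1` over `V`. -/
abbrev U1μR {k : ℕ} (V : Opens (N k)) (μ : ℂ) : DiffOp V := diffRes le_top (U1μ k μ)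

/-- A constant, as an operator over `V`. -/
abbrev constR {k : ℕ} (V : Opens (N k)) (c : ℂ) : DiffOp V := diffRes le_top (const k c)

theorem opAt_constR {k : ℕ} {V : Opens (N k)} (z : V) (c : ℂ) (u : O z.1) :
    opAt z (constR V c) u = c • u := by
  rw [constR, diffRes_const, opAt_mulHom, AlgHom.commutes, ← Algebra.smul_def]

theorem U0R_eq {k : ℕ} (V : Opens (N k)) : U0R V = ∑ h ∈ Finset.Icc 1 k,
    mulHom V (algebraMap ℂ (holo V) h * coord V h) * pdR V h := by
  rw [U0R, U0, map_sum]
  refine Finset.sum_congr rfl fun h _ => ?_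
  rw [map_mul, map_mul, diffRes_const, diffRes_σ, map_mul (mulHom V)]

theorem Um1R_eq {k : ℕ} (V : Opens (N k)) : Um1R V = ∑ h ∈ Finset.range k,
    mulHom V (algebraMap ℂ (holo V) ((k : ℂ) - h) * coord V h) * pdR V (h + 1) := by
  rw [Um1R, Um1, map_sum]
  refine Finset.sum_congr rfl fun h _ => ?_
  rw [map_mul, map_mul, diffRes_const, diffRes_σ, map_mul (mulHom V)]

theorem U1μR_eq {k : ℕ} (V : Opens (N k)) (μ : ℂ) : U1μR V μ = ∑ h ∈ Finset.Icc 1 k,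
    mulHom V (coord V 1 * coord V h - algebraMap ℂ (holo V) (h + 1) * coord V (h + 1)) * pdR V h +
      mulHom V (algebraMap ℂ (holo V) μ * coord V 1) := by
  rw [U1μR, U1μ, U1, map_add, map_sum, map_mul (mulHom V) (algebraMap ℂ (holo V) μ), map_mul,
    diffRes_const, diffRes_σ]
  congr 1
  refine Finset.sum_congr rfl fun h _ => ?_
  rw [map_mul, map_sub, map_mul, map_mul, diffRes_const, diffRes_σ, diffRes_σ, diffRes_σ,
    map_sub (mulHom V), map_mul (mulHom V), map_mul (mulHom V)]

theorem U0R_mem {k : ℕ} (V : Opens (N k)) : U0R V ∈ genSub V := by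
  rw [U0R_eq]
  exact sum_mem fun h _ => mul_mem (mulHom_mem V _) (pdR_mem V _)

theorem Um1R_mem {k : ℕ} (V : Opens (N k)) : Um1R V ∈ genSub V := by
  rw [Um1R_eq]
  exact sum_mem fun h _ => mul_mem (mulHom_mem V _) (pdR_mem V _)

theorem eulerR_mem {k : ℕ} (V : Opens (N k)) : eulerR V ∈ genSub V := by
  rw [eulerR_eq]
  exact sum_mem fun h _ => mul_mem (mulHom_mem V _) (pdR_mem V _)

theorem U1μR_mem {k : ℕ} (V : Opens (N k)) (μ : ℂ) : U1μR V μ ∈ genSub V := by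
  rw [U1μR_eq]
  exact add_mem (sum_mem fun h _ => mul_mem (mulHom_mem V _) (pdR_mem V _)) (mulHom_mem V _)

theorem constR_mem {k : ℕ} (V : Opens (N k)) (c : ℂ) : constR V c ∈ genSub V := by
  rw [constR, diffRes_const]
  exact mulHom_mem V _

theorem opAt_U0R {k : ℕ} {V : Opens (N k)} (z : V) (x : ℂ) (n : ℤ) :
    opAt z (U0R V) (toGerm z (traceFun V x n)) = (n : ℂ) • toGerm z (traceFun V x n) := by
  rw [U0R_eq, opAt_sum_mulHom_mul_pdR z _ _ (fun h => h) fun h hh => hh, ← map_smul]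
  congr 1
  refine holo_ext fun w => ?_
  rw [holo_sum_apply]
  change ∑ h ∈ Finset.Icc 1 k, (h : ℂ) * coordFun k h w * (-x * traceCoeff k (x + 1) (n - h) w) =
    n * traceCoeff k x n w
  exact sum_mul_coordFun_mul_traceCoeff k x n w

theorem opAt_eulerR {k : ℕ} {V : Opens (N k)} (z : V) (x : ℂ) (n : ℤ) :
    opAt z (eulerR V + constR V x) (toGerm z (traceFun V x n)) =
      x • toGerm z (traceFun V (x + 1) n) := by
  rw [map_add, LinearMap.add_apply, opAt_constR, eulerR_eq,
    opAt_sum_mulHom_mul_pdR z _ _ (fun h => h) fun h hh => hh, ← map_smul, ← map_smul, ← map_add]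
  congr 1
  refine holo_ext fun w => ?_
  change (∑ h ∈ Finset.Icc 1 k, coord V h * (-x) • traceFun V (x + 1) (n - h)).1 w +
    x * traceCoeff k x n w = x * traceCoeff k (x + 1) n w
  rw [holo_sum_apply, ← sum_coordFun_mul_traceCoeff, mul_add, Finset.mul_sum, add_left_comm,
    ← Finset.sum_add_distrib]
  rw [Finset.sum_eq_zero, add_zero]
  intro h _
  change coordFun k h w * (-x * traceCoeff k (x + 1) (n - h) w) + _ = _
  ring

/-- Since Σ (k - h) σ_h t^h = k S - t S', the left side is the coefficient of t^(n-1) in -x (k S - t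
S') S^(-x-1) = -k x S^(-x) - t (S^(-x))'. The term h = k has coefficient zero, so the sum may be
extended to it. -/
theorem opAt_Um1R {k : ℕ} {V : Opens (N k)} (z : V) (x : ℂ) (n : ℤ) :
    opAt z (Um1R V) (toGerm z (traceFun V x n)) =
      (-(n - 1 + k * x)) • toGerm z (traceFun V x (n - 1)) := by
  rw [Um1R_eq, opAt_sum_mulHom_mul_pdR z _ _ (fun h => h + 1) (fun h hh => by
    rw [Finset.mem_range] at hh; rw [Finset.mem_Icc]; omega), ← map_smul]
  congr 1
  refine holo_ext fun w => ?_
  rw [holo_sum_apply]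
  change ∑ h ∈ Finset.range k, ((k : ℂ) - h) * coordFun k h w *
    (-x * traceCoeff k (x + 1) (n - (h + 1 : ℕ)) w) = -(n - 1 + k * x) * traceCoeff k x (n - 1) w
  have h1 := sum_range_succ_eq_add_sum_Icc k fun h => ((k : ℂ) - h) * coordFun k h w *
    (-x * traceCoeff k (x + 1) (n - (h + 1 : ℕ)) w)
  rw [Finset.sum_range_succ, sub_self, zero_mul, zero_mul, add_zero] at h1
  have h2 := sum_mul_coordFun_mul_traceCoeff k x (n - 1) w
  have h3 := sum_coordFun_mul_traceCoeff k x (n - 1) w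
  have h4 : ∑ h ∈ Finset.Icc 1 k, ((k : ℂ) - h) * coordFun k h w *
      (-x * traceCoeff k (x + 1) (n - (h + 1 : ℕ)) w) =
      -(k * x) * ∑ h ∈ Finset.Icc 1 k, coordFun k h w * traceCoeff k (x + 1) (n - 1 - h) w -
      ∑ h ∈ Finset.Icc 1 k, (h : ℂ) * coordFun k h w *
        (-x * traceCoeff k (x + 1) (n - 1 - h) w) := by
    rw [Finset.mul_sum, ← Finset.sum_sub_distrib]
    refine Finset.sum_congr rfl fun h _ => ?_
    rw [show n - (h + 1 : ℕ) = n - 1 - h by push_cast; ring]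
    ring
  rw [h1, h4, h2, coordFun_zero]
  simp only [Nat.cast_zero, zero_add, Nat.cast_one]
  push_cast
  linear_combination -(k * x : ℂ) * h3

/-- The sum of the (h + 1) σ_{h+1} terms is the one for t (S^(-x))' at degree n + 1 without its
first term. The missing term is a multiple of σ_1 and is balanced by what Σ σ_1 σ_h ∂_h and x σ_1
leave together. -/
theorem opAt_U1μR {k : ℕ} {V : Opens (N k)} (z : V) (x : ℂ) (n : ℤ) :
    opAt z (U1μR V x) (toGerm z (traceFun V x n)) =
      (-(n + 1 : ℂ)) • toGerm z (traceFun V x (n + 1)) := by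
  rw [U1μR_eq, map_add, LinearMap.add_apply, opAt_mulHom,
    opAt_sum_mulHom_mul_pdR z _ _ (fun h => h) fun h hh => hh, ← map_smul, ← map_mul, ← map_add]
  congr 1
  refine holo_ext fun w => ?_
  change (∑ h ∈ Finset.Icc 1 k, (coord V 1 * coord V h -
    algebraMap ℂ (holo V) (h + 1) * coord V (h + 1)) * (-x) • traceFun V (x + 1) (n - h)).1 w +
    x * coordFun k 1 w * traceCoeff k x n w = -(n + 1) * traceCoeff k x (n + 1) w
  rw [holo_sum_apply]
  have h1 := sum_Icc_succ_add k fun h => (h : ℂ) * coordFun k h w *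
    (-x * traceCoeff k (x + 1) (n + 1 - h) w)
  rw [coordFun_of_lt (Nat.lt_succ_self k), mul_zero, zero_mul, add_zero,
    sum_mul_coordFun_mul_traceCoeff k x (n + 1) w] at h1
  have h3 := sum_coordFun_mul_traceCoeff k x n w
  have h4 : ∑ h ∈ Finset.Icc 1 k, ((coord V 1 * coord V h -
      algebraMap ℂ (holo V) (h + 1) * coord V (h + 1)) *
        (-x) • traceFun V (x + 1) (n - h) : holo V).1 w =
      -x * coordFun k 1 w *
        ∑ h ∈ Finset.Icc 1 k, coordFun k h w * traceCoeff k (x + 1) (n - h) w -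
      ∑ h ∈ Finset.Icc 1 k, ((h + 1 : ℕ) : ℂ) * coordFun k (h + 1) w *
        (-x * traceCoeff k (x + 1) (n + 1 - (h + 1 : ℕ)) w) := by
    rw [Finset.mul_sum, ← Finset.sum_sub_distrib]
    refine Finset.sum_congr rfl fun h _ => ?_
    change (coordFun k 1 w * coordFun k h w - ((h : ℂ) + 1) * coordFun k (h + 1) w) *
      (-x * traceCoeff k (x + 1) (n - h) w) = _
    rw [show n + 1 - (h + 1 : ℕ) = n - h by push_cast; ring]
    push_cast
    ring
  rw [h4]
  simp only [Nat.cast_one, add_sub_cancel_right] at h1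
  push_cast at h1 ⊢
  linear_combination -h1 - x * coordFun k 1 w * h3

/-! ### Normal forms modulo `𝓘_μ`, and `𝓘_μ` as an annihilator -/

/-- The left ideal of `D_N(V)` generated by the restrictions of the elements of `S`. -/
abbrev spanR {k : ℕ} (V : Opens (N k)) (S : Set (GlobalOps k)) : Ideal (DiffOp V) :=
  Ideal.span (diffRes (le_top : V ≤ ⊤) '' S)

theorem diffRes_mem_spanR {k : ℕ} (V : Opens (N k)) {S : Set (GlobalOps k)} {P : GlobalOps k}
    (hP : P ∈ S) : diffRes le_top P ∈ spanR V S :=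
  Ideal.subset_span ⟨P, hP, rfl⟩

/-- Telescoping the relations A along a line of constant i + j. -/
theorem pdR_mul_sub_mem {k : ℕ} (V : Opens (N k)) (μ : ℂ) {i j t : ℕ} (hi : 1 ≤ i) (hj : j ≤ k)
    (hit : i + t ≤ k) (htj : t < j) :
    pdR V i * pdR V j - pdR V (i + t) * pdR V (j - t) ∈ spanR V (genI k μ) := by
  induction t with
  | zero => simp
  | succ t ih =>
    have h1 : diffRes le_top (A k (i + t) (j - t)) ∈ spanR V (genI k μ) :=
      diffRes_mem_spanR V (Or.inl ⟨i + t, j - t, by omega, by omega, by omega, by omega, rfl⟩)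
    rw [A, map_sub, map_mul, map_mul] at h1
    have h2 := add_mem (ih (by omega) (by omega)) h1
    rw [sub_add_sub_cancel, Nat.sub_sub] at h2
    exact h2

theorem pdR_one_mul_add_mem {k : ℕ} (V : Opens (N k)) (μ : ℂ) {m : ℕ} (h2 : 2 ≤ m) (hm : m ≤ k) :
    pdR V 1 * pdR V (m - 1) + pdR V m * (eulerR V + constR V μ) ∈ spanR V (genI k μ) := by
  have h1 : diffRes le_top (T k μ m) ∈ spanR V (genI k μ) :=
    diffRes_mem_spanR V (Or.inr ⟨m, h2, hm, rfl⟩)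
  rwa [T, map_add, map_mul, map_mul, map_add] at h1

/-- The operators `1` and `∂_k^a ∂_r`, which generate `D_N` modulo `𝓘_μ`, over the holomorphic
functions. -/
def monomialR {k : ℕ} (V : Opens (N k)) : ℕ → DiffOp V
  | 0 => 1
  | m + 1 => pdR V k ^ (m / k) * pdR V (m % k + 1)

/-- The order of `monomialR V m`. -/
def monomialOrder (k : ℕ) : ℕ → ℕ
  | 0 => 0
  | m + 1 => m / k + 1

theorem pow_mul_pdR_eq_monomialR {k : ℕ} (V : Opens (N k)) (a : ℕ) {r : ℕ} (h1 : 1 ≤ r)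
    (hr : r ≤ k) : pdR V k ^ a * pdR V r = monomialR V (a * k + (r - 1) + 1) := by
  have hk : 0 < k := by omega
  rw [monomialR, Nat.add_comm (a * k), Nat.add_mul_div_right _ _ hk, Nat.add_mul_mod_self_right,
    Nat.div_eq_of_lt (by omega), Nat.mod_eq_of_lt (by omega), zero_add, Nat.sub_add_cancel h1]

/-- The combination of the operators `monomialR V m` with given coefficients. -/
def monomialSum {k : ℕ} (V : Opens (N k)) : (ℕ →₀ holo V) →+ DiffOp V :=
  Finsupp.liftAddHom fun m => (AddMonoidHom.mulRight (monomialR V m)).comp (mulHom V).toAddMonoidHom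

theorem monomialSum_single {k : ℕ} (V : Opens (N k)) (m : ℕ) (f : holo V) :
    monomialSum V (Finsupp.single m f) = mulHom V f * monomialR V m :=
  Finsupp.liftAddHom_apply_single _ _ _

theorem monomialSum_apply {k : ℕ} (V : Opens (N k)) (f : ℕ →₀ holo V) :
    monomialSum V f = ∑ m ∈ f.support, mulHom V (f m) * monomialR V m := rfl

/-- The operators that have a normal form. -/
def normalForms {k : ℕ} (V : Opens (N k)) (μ : ℂ) : AddSubmonoid (DiffOp V) :=
  AddMonoidHom.mrange (monomialSum V) ⊔ (spanR V (genI k μ)).toAddSubmonoid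

theorem mem_normalForms_of_mem_spanR {k : ℕ} {V : Opens (N k)} {μ : ℂ} {P : DiffOp V}
    (hP : P ∈ spanR V (genI k μ)) : P ∈ normalForms V μ :=
  AddSubmonoid.mem_sup_right hP

theorem monomialR_mem_normalForms {k : ℕ} (V : Opens (N k)) (μ : ℂ) (m : ℕ) :
    monomialR V m ∈ normalForms V μ :=
  AddSubmonoid.mem_sup_left ⟨Finsupp.single m 1, by rw [monomialSum_single, map_one, one_mul]⟩

theorem normalForms_induction {k : ℕ} {V : Opens (N k)} {μ : ℂ} {S : AddSubmonoid (DiffOp V)}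
    {L : DiffOp V} (hI : ∀ P ∈ spanR V (genI k μ), L * P ∈ S)
    (hm : ∀ f m, L * (mulHom V f * monomialR V m) ∈ S) {P : DiffOp V} (hP : P ∈ normalForms V μ) :
    L * P ∈ S := by
  obtain ⟨_, ⟨f, rfl⟩, i, hi, rfl⟩ := AddSubmonoid.mem_sup.1 hP
  rw [mul_add]
  refine add_mem ?_ (hI i hi)
  rw [monomialSum_apply, Finset.mul_sum]
  exact sum_mem fun m _ => hm _ _

theorem mulHom_mul_mem_normalForms {k : ℕ} {V : Opens (N k)} {μ : ℂ} (g : holo V) {P : DiffOp V}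
    (hP : P ∈ normalForms V μ) : mulHom V g * P ∈ normalForms V μ := by
  refine normalForms_induction
    (fun P hP => mem_normalForms_of_mem_spanR (Ideal.mul_mem_left _ _ hP))
    (fun f m => ?_) hP
  rw [← mul_assoc, ← map_mul, ← monomialSum_single]
  exact AddSubmonoid.mem_sup_left ⟨_, rfl⟩

theorem constR_comm_pdR {k : ℕ} (V : Opens (N k)) (c : ℂ) (h : ℕ) :
    Commute (constR V c) (pdR V h) := by
  refine diffOp_ext fun z u => ?_
  rw [map_mul, map_mul, Module.End.mul_apply, Module.End.mul_apply, opAt_constR, opAt_constR,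
    map_smul]

theorem constR_add {k : ℕ} (V : Opens (N k)) (c d : ℂ) :
    constR V (c + d) = constR V c + constR V d := by
  rw [constR, diffRes_const, map_add, map_add]
  rfl

theorem constR_natCast {k : ℕ} (V : Opens (N k)) (n : ℕ) : constR V n = n := by
  rw [constR, diffRes_const, map_natCast, map_natCast]

/-- Descending induction on j + r. If j + r > k, the relations A move the product to ∂_k ∂_{j+r-k}.
Otherwise they move it to ∂_1 ∂_{j+r-1}, which the relation T replaces by -∂_{j+r} (E + μ); its
second-order terms are σ_h ∂_h ∂_{j+r}, with a larger index sum. -/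
theorem pow_mul_pdR_mul_pdR_mem {k : ℕ} (V : Opens (N k)) (μ : ℂ) (a : ℕ) {j r : ℕ}
    (hj : j ∈ Finset.Icc 1 k) (hr : r ∈ Finset.Icc 1 k) :
    pdR V k ^ a * (pdR V j * pdR V r) ∈ normalForms V μ := by
  have key : ∀ d j r : ℕ, 2 * k - (j + r) ≤ d → 1 ≤ j → j ≤ k → 1 ≤ r → r ≤ k →
      pdR V k ^ a * (pdR V j * pdR V r) ∈ normalForms V μ := by
    intro d
    induction d with
    | zero =>
      intro j r h _ hj _ hr
      obtain rfl : j = k := by omega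
      obtain rfl : r = j := by omega
      rw [← mul_assoc, ← pow_succ, pow_mul_pdR_eq_monomialR V (a + 1) (by omega) le_rfl]
      exact monomialR_mem_normalForms V μ _
    | succ d ih =>
      intro j r h hj1 hj hr1 hr
      by_cases hs : k < j + r
      · have h1 := pdR_mul_sub_mem V μ (i := j) (j := r) (t := k - j) hj1 hr (by omega) (by omega)
        rw [show j + (k - j) = k by omega] at h1
        have h2 := mem_normalForms_of_mem_spanR (Ideal.mul_mem_left _ (pdR V k ^ a) h1)
        rw [mul_sub, ← mul_assoc _ (pdR V k), ← pow_succ,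
          pow_mul_pdR_eq_monomialR V (a + 1) (by omega) (by omega)] at h2
        have h3 := add_mem h2 (monomialR_mem_normalForms V μ ((a + 1) * k + (r - (k - j) - 1) + 1))
        rwa [sub_add_cancel] at h3
      · have h1 := pdR_mul_sub_mem V μ (i := 1) (j := j + r - 1) (t := j - 1) le_rfl (by omega)
          (by omega) (by omega)
        rw [show 1 + (j - 1) = j by omega, show j + r - 1 - (j - 1) = r by omega] at h1
        have h2 := sub_mem (pdR_one_mul_add_mem V μ (m := j + r) (by omega) (by omega)) h1
        rw [add_sub_sub_cancel] at h2
        have h3 := mem_normalForms_of_mem_spanR (Ideal.mul_mem_left _ (pdR V k ^ a) h2)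
        have h4 : pdR V k ^ a * (pdR V (j + r) * (eulerR V + constR V μ)) =
            ∑ h ∈ Finset.Icc 1 k, mulHom V (coord V h) *
              (pdR V k ^ a * (pdR V h * pdR V (j + r))) +
            mulHom V (algebraMap ℂ (holo V) (a + 1 + μ)) * (pdR V k ^ a * pdR V (j + r)) := by
          have h5 : pdR V k ^ a * (pdR V (j + r) * (eulerR V + constR V μ)) =
              (eulerR V + constR V (a + 1 + μ)) * (pdR V k ^ a * pdR V (j + r)) := by
            have hk1 : k ∈ Finset.Icc 1 k := Finset.mem_Icc.2 ⟨by omega, le_rfl⟩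
            have hs1 : j + r ∈ Finset.Icc 1 k := Finset.mem_Icc.2 ⟨by omega, by omega⟩
            have h6 : constR V (a + 1 + μ) = (a : DiffOp V) + 1 + constR V μ := by
              rw [constR_add, ← Nat.cast_add_one, constR_natCast, Nat.cast_add_one]
            rw [mul_add, mul_add, pdR_mul_eulerR V hs1, ← mul_assoc, mul_add,
              pdR_pow_mul_eulerR V hk1, h6, ← (constR_comm_pdR V μ _).eq, ← mul_assoc _ (constR V μ),
              ← ((constR_comm_pdR V μ k).pow_right a).eq]
            noncomm_ring
          rw [h5, add_mul, eulerR_eq, Finset.sum_mul, constR, diffRes_const]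
          congr 1
          refine Finset.sum_congr rfl fun h _ => ?_
          rw [← mul_assoc (pdR V k ^ a), ← ((pdR_comm V h k).pow_right a).eq]
          simp only [mul_assoc]
        rw [mul_add, h4] at h3
        have h5 : pdR V k ^ a * pdR V (j + r) ∈ normalForms V μ := by
          rw [pow_mul_pdR_eq_monomialR V a (by omega) (by omega)]
          exact monomialR_mem_normalForms V μ _
        have h6 : ∑ h ∈ Finset.Icc 1 k, mulHom V (coord V h) *
            (pdR V k ^ a * (pdR V h * pdR V (j + r))) ∈ normalForms V μ :=
          sum_mem fun h hh => mulHom_mul_mem_normalForms _ (by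
            rw [Finset.mem_Icc] at hh
            exact ih h (j + r) (by omega) hh.1 hh.2 (by omega) (by omega))
        -- `normalForms` is only an additive submonoid, so subtraction is performed by multiplying
        -- with the function -1.
        have h7 := add_mem h3 (mulHom_mul_mem_normalForms (-1)
          (add_mem h6 (mulHom_mul_mem_normalForms (algebraMap ℂ (holo V) (a + 1 + μ)) h5)))
        rwa [map_neg, map_one, neg_one_mul, add_neg_cancel_comm] at h7
  rw [Finset.mem_Icc] at hj hr
  exact key _ j r le_rfl hj.1 hj.2 hr.1 hr.2

theorem pdR_mul_mem_normalForms {k : ℕ} {V : Opens (N k)} {μ : ℂ} {h : ℕ}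
    (hh : h ∈ Finset.Icc 1 k) {P : DiffOp V}
    (hP : P ∈ normalForms V μ) : pdR V h * P ∈ normalForms V μ := by
  refine normalForms_induction
    (fun P hP => mem_normalForms_of_mem_spanR (Ideal.mul_mem_left _ _ hP))
    (fun f m => ?_) hP
  have hh' := Finset.mem_Icc.1 hh
  rw [pdR_eq_dd V hh'.1 hh'.2, ← mul_assoc, dd_mul_mulHom, add_mul, mul_assoc,
    ← pdR_eq_dd V hh'.1 hh'.2]
  refine add_mem (mulHom_mul_mem_normalForms _ ?_)
    (mulHom_mul_mem_normalForms _ (monomialR_mem_normalForms V μ m))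
  cases m with
  | zero =>
    have h1 := pow_mul_pdR_eq_monomialR V 0 hh'.1 hh'.2
    rw [pow_zero, one_mul] at h1
    rw [monomialR, mul_one, h1]
    exact monomialR_mem_normalForms V μ _
  | succ m =>
    rw [monomialR, ← mul_assoc, ((pdR_comm V h k).pow_right _).eq, mul_assoc]
    exact pow_mul_pdR_mul_pdR_mem V μ _ hh
      (Finset.mem_Icc.2 ⟨by omega, Nat.mod_lt _ (by omega)⟩)

theorem exists_normalForm {k : ℕ} {V : Opens (N k)} (μ : ℂ) {P : DiffOp V} (hP : P ∈ genSub V) :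
    ∃ f : ℕ →₀ holo V, P - monomialSum V f ∈ spanR V (genI k μ) := by
  have h : P ∈ normalForms V μ := by
    refine genSub_induction (p := (· ∈ normalForms V μ))
      (fun f Q hQ => mulHom_mul_mem_normalForms f hQ) (fun i Q hQ => ?_)
      (fun P Q hP hQ => add_mem hP hQ) (fun P hP => ?_)
      (monomialR_mem_normalForms V μ 0) hP
    · rw [dd_eq_pdR]
      exact pdR_mul_mem_normalForms (Finset.mem_Icc.2 ⟨by omega, by omega⟩) hQ
    · rw [← neg_one_mul, ← map_one (mulHom V), ← map_neg]
      exact mulHom_mul_mem_normalForms _ hP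
  obtain ⟨_, ⟨f, rfl⟩, i, hi, rfl⟩ := AddSubmonoid.mem_sup.1 h
  exact ⟨f, by rw [add_sub_cancel_left]; exact hi⟩

/-- The product `(-x) (-(x + 1)) ⋯ (-(x + n - 1))`. -/
def descProd (x : ℂ) : ℕ → ℂ
  | 0 => 1
  | n + 1 => -(x + n) * descProd x n

theorem descProd_ne_zero {x : ℂ} (hx : ∀ n : ℤ, x ≠ n) (j : ℕ) : descProd x j ≠ 0 := by
  induction j with
  | zero => exact one_ne_zero
  | succ j ih =>
    have h1 : x + j ≠ 0 := fun h => hx (-j) (by push_cast; linear_combination h)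
    exact mul_ne_zero (neg_ne_zero.2 h1) ih

theorem opAt_pdR_pow {k : ℕ} {V : Opens (N k)} (z : V) {h : ℕ} (hh : h ∈ Finset.Icc 1 k) (x : ℂ)
    (n : ℤ) (a : ℕ) : opAt z (pdR V h ^ a) (toGerm z (traceFun V x n)) =
      descProd x a • toGerm z (traceFun V (x + a) (n - a * h)) := by
  induction a with
  | zero => simp [descProd]
  | succ a ih =>
    rw [pow_succ', map_mul, Module.End.mul_apply, ih, map_smul, opAt_pdR z hh, smul_smul, descProd]
    push_cast
    rw [show x + a + 1 = x + (a + 1) by ring, show n - a * h - h = n - (a + 1) * h by ring,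
      mul_comm]

/-- For m = a k + r with 1 ≤ r ≤ k, the operator ∂_k^a ∂_r has weight m and order a + 1: the weight
lowers the index and the order raises the exponent. Distinct monomials therefore have distinct
weights. -/
theorem opAt_monomialR {k : ℕ} {V : Opens (N k)} (hk : 0 < k) (z : V) (x : ℂ) (n : ℤ) (m : ℕ) :
    opAt z (monomialR V m) (toGerm z (traceFun V x n)) =
      descProd x (monomialOrder k m) •
        toGerm z (traceFun V (x + monomialOrder k m) (n - m)) := by
  cases m with
  | zero => simp [monomialR, monomialOrder, descProd]
  | succ m =>
    rw [monomialR, ((pdR_comm V k _).pow_left _).eq, map_mul, Module.End.mul_apply,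
      opAt_pdR_pow z (Finset.mem_Icc.2 ⟨hk, le_rfl⟩), map_smul,
      opAt_pdR z (Finset.mem_Icc.2 ⟨by omega, Nat.mod_lt _ hk⟩), smul_smul, monomialOrder, descProd]
    have h1 : (m : ℤ) = (m / k : ℕ) * k + (m % k : ℕ) := by exact_mod_cast (Nat.div_add_mod' m k).symm
    have h2 : n - ((m / k : ℕ) : ℤ) * k - ((m % k + 1 : ℕ) : ℤ) = n - ((m + 1 : ℕ) : ℤ) := by
      push_cast at h1 ⊢
      omega
    rw [h2]
    push_cast
    rw [add_assoc, mul_comm]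

/-- The value at `z` of the image by `P` of the coefficient of `t^n` in
`(1 + σ_1 t + ⋯ + σ_k t^k)^(-μ)`. -/
def traceValue {k : ℕ} {V : Opens (N k)} (μ : ℂ) (z : V) (n : ℤ) : DiffOp V →+ ℂ where
  toFun P := valueAt z.1 (opAt z P (toGerm z (traceFun V μ n)))
  map_zero' := by rw [map_zero, LinearMap.zero_apply, map_zero]
  map_add' P Q := by rw [map_add, LinearMap.add_apply, map_add]

theorem traceValue_apply {k : ℕ} {V : Opens (N k)} (μ : ℂ) (z : V) (n : ℤ) (P : DiffOp V) :
    traceValue μ z n P = valueAt z.1 (opAt z P (toGerm z (traceFun V μ n))) := rfl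

theorem traceValue_monomialSum {k : ℕ} {V : Opens (N k)} (hk : 0 < k) (μ : ℂ) (z : V) (n : ℤ)
    (f : ℕ →₀ holo V) : traceValue μ z n (monomialSum V f) = ∑ m ∈ f.support, (f m).1 z.1 *
      (descProd μ (monomialOrder k m) * traceCoeff k (μ + monomialOrder k m) (n - m) z.1) := by
  rw [monomialSum_apply, map_sum]
  refine Finset.sum_congr rfl fun m _ => ?_
  rw [traceValue_apply, map_mul, Module.End.mul_apply, opAt_monomialR hk, opAt_mulHom, map_mul,
    map_smul, valueAt_toGerm, valueAt_toGerm]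
  rfl

/-- On c_n a product ∂_i ∂_j depends only on i + j, which handles A; in T the two terms have
opposite scalars μ(μ + 1) and -μ(μ + 1). -/
theorem opAt_eq_zero_of_mem_spanR {k : ℕ} {V : Opens (N k)} {μ : ℂ} {P : DiffOp V}
    (hP : P ∈ spanR V (genI k μ)) (z : V) (n : ℤ) : opAt z P (toGerm z (traceFun V μ n)) = 0 := by
  refine Submodule.span_induction ?_ ?_ ?_ ?_ hP
  · rintro _ ⟨_, ⟨i, j, hi, hik, hj, hjk, rfl⟩ | ⟨m, hm, hmk, rfl⟩, rfl⟩
    · rw [A, map_sub, map_mul, map_mul, map_sub, map_mul, map_mul, LinearMap.sub_apply,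
        Module.End.mul_apply, Module.End.mul_apply]
      rw [opAt_pdR z (Finset.mem_Icc.2 ⟨by omega, hjk⟩), map_smul,
        opAt_pdR z (Finset.mem_Icc.2 ⟨by omega, by omega⟩),
        opAt_pdR z (h := j - 1) (Finset.mem_Icc.2 ⟨by omega, by omega⟩), map_smul,
        opAt_pdR z (h := i + 1) (Finset.mem_Icc.2 ⟨by omega, by omega⟩),
        show n - j - i = n - (j - 1 : ℕ) - (i + 1 : ℕ) by omega, sub_self]
    · rw [T, map_add, map_mul, map_mul, map_add, map_add, map_mul, map_mul, LinearMap.add_apply,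
        Module.End.mul_apply, Module.End.mul_apply, opAt_eulerR, map_smul]
      rw [opAt_pdR z (h := m - 1) (Finset.mem_Icc.2 ⟨by omega, by omega⟩), map_smul,
        opAt_pdR z (h := 1) (Finset.mem_Icc.2 ⟨by omega, by omega⟩),
        opAt_pdR z (Finset.mem_Icc.2 ⟨by omega, by omega⟩),
        show n - (m - 1 : ℕ) - (1 : ℕ) = n - m by omega, smul_smul, smul_smul,
        ← add_smul]
      rw [show -μ * -(μ + 1) + μ * -(μ + 1) = 0 by ring, zero_smul]
  · simp
  · intro P Q _ _ hP hQ
    rw [map_add, LinearMap.add_apply, hP, hQ, add_zero]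
  · intro L P _ hP
    rw [smul_eq_mul, map_mul, Module.End.mul_apply, hP, map_zero]

theorem traceValue_eq_zero_of_mem_spanR {k : ℕ} {V : Opens (N k)} {μ : ℂ} {P : DiffOp V}
    (hP : P ∈ spanR V (genI k μ)) (z : V) (n : ℤ) : traceValue μ z n P = 0 := by
  rw [traceValue_apply, opAt_eq_zero_of_mem_spanR hP, map_zero]

/-- Elements of `holo V` are functions on all of ℂ^k, so vanishing on `V` is weaker than being zero
in `holo V`; the operator sees only `V`. -/
theorem mulHom_eq_zero {k : ℕ} {V : Opens (N k)} {f : holo V} (hf : ∀ z : V, f.1 z.1 = 0) :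
    mulHom V f = 0 := by
  refine diffOp_ext fun z u => ?_
  have h1 : toGerm z f = 0 := by
    apply Subtype.ext
    refine Germ.coe_eq.2 ?_
    filter_upwards [V.isOpen.mem_nhds z.2] with w hw
    exact hf ⟨w, hw⟩
  rw [opAt_mulHom, h1, zero_mul, map_zero, LinearMap.zero_apply]

/-- The left ideal `𝓘_μ` is the annihilator of the coefficients of
`(1 + σ_1 t + ⋯ + σ_k t^k)^(-μ)`. -/
theorem mem_spanR_genI_of_traceValue {k : ℕ} {V : Opens (N k)} (hk : 0 < k) {μ : ℂ}
    (hμ : ∀ n : ℤ, μ ≠ n) {P : DiffOp V} (hP : P ∈ genSub V)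
    (h : ∀ (z : V) (n : ℕ), traceValue μ z n P = 0) : P ∈ spanR V (genI k μ) := by
  obtain ⟨f, hf⟩ := exists_normalForm μ hP
  have h1 : ∀ (z : V) (n : ℕ), ∑ m ∈ f.support, (f m).1 z.1 *
      (descProd μ (monomialOrder k m) * traceCoeff k (μ + monomialOrder k m) (n - m) z.1) = 0 := by
    intro z n
    have h2 := traceValue_eq_zero_of_mem_spanR hf z n
    rw [map_sub, h, zero_sub, neg_eq_zero, traceValue_monomialSum hk] at h2
    exact_mod_cast h2
  have h2 : ∀ (z : V) (m : ℕ), (f m).1 z.1 = 0 := by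
    intro z m
    -- The system is triangular: testing on c_m, the monomials of weight above m give coefficients
    -- of negative index, those below are handled by induction, and weight m contributes c_0 = 1
    -- times a nonzero constant.
    induction m using Nat.strong_induction_on with
    | _ m ih =>
      by_cases hm : f m = 0
      · rw [hm]; rfl
      have h3 := h1 z m
      rw [Finset.sum_eq_single_of_mem m (Finsupp.mem_support_iff.2 hm), sub_self, traceCoeff_zero,
        mul_one] at h3
      · exact (mul_eq_zero.1 h3).resolve_right (descProd_ne_zero hμ _)
      · intro i _ hi
        rcases lt_or_gt_of_ne hi with hi | hi
        · rw [ih i hi, zero_mul]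
        · rw [traceCoeff_of_neg (by omega), mul_zero, mul_zero]
  have h3 : monomialSum V f = 0 := by
    rw [monomialSum_apply]
    exact Finset.sum_eq_zero fun m _ => by rw [mulHom_eq_zero fun z => h2 z m, zero_mul]
  rwa [h3, sub_zero] at hf

/-! ### The ideals `𝓙_{μ,λ}` and `H_μ` -/

theorem spanR_mono {k : ℕ} (V : Opens (N k)) {S S' : Set (GlobalOps k)} (h : S ⊆ S') :
    spanR V S ≤ spanR V S' :=
  Ideal.span_mono (Set.image_mono h)

theorem traceValue_mul_constR {k : ℕ} {V : Opens (N k)} (μ : ℂ) (z : V) (n : ℤ) (P : DiffOp V)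
    (c : ℂ) : traceValue μ z n (P * constR V c) = c * traceValue μ z n P := by
  rw [traceValue_apply, map_mul, Module.End.mul_apply, opAt_constR, map_smul, map_smul]
  rfl

theorem traceValue_constR_mul {k : ℕ} {V : Opens (N k)} (μ : ℂ) (z : V) (n : ℤ) (P : DiffOp V)
    (c : ℂ) : traceValue μ z n (constR V c * P) = c * traceValue μ z n P := by
  rw [traceValue_apply, map_mul, Module.End.mul_apply, opAt_constR, map_smul]
  rfl

theorem traceValue_mul_U0R {k : ℕ} {V : Opens (N k)} (μ : ℂ) (z : V) (n : ℤ) (P : DiffOp V) :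
    traceValue μ z n (P * U0R V) = n * traceValue μ z n P := by
  rw [traceValue_apply, map_mul, Module.End.mul_apply, opAt_U0R, map_smul, map_smul]
  rfl

theorem traceValue_mul_Um1R {k : ℕ} {V : Opens (N k)} (μ : ℂ) (z : V) (n : ℤ) (P : DiffOp V) :
    traceValue μ z n (P * Um1R V) = -(n - 1 + k * μ) * traceValue μ z (n - 1) P := by
  rw [traceValue_apply, map_mul, Module.End.mul_apply, opAt_Um1R, map_smul, map_smul]
  rfl

theorem traceValue_mul_U1μR {k : ℕ} {V : Opens (N k)} (μ : ℂ) (z : V) (n : ℤ) (P : DiffOp V) :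
    traceValue μ z n (P * U1μR V μ) = -(n + 1) * traceValue μ z (n + 1) P := by
  rw [traceValue_apply, map_mul, Module.End.mul_apply, opAt_U1μR, map_smul, map_smul]
  rfl

theorem traceValue_pdR {k : ℕ} {V : Opens (N k)} (μ : ℂ) (z : V) (n : ℤ) {h : ℕ}
    (hh : h ∈ Finset.Icc 1 k) :
    traceValue μ z n (pdR V h) = -μ * traceCoeff k (μ + 1) (n - h) z.1 := by
  rw [traceValue_apply, opAt_pdR z hh, map_smul]
  rfl

theorem traceValue_eulerR {k : ℕ} {V : Opens (N k)} (μ : ℂ) (z : V) (n : ℤ) :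
    traceValue μ z n (eulerR V + constR V μ) = μ * traceCoeff k (μ + 1) n z.1 := by
  rw [traceValue_apply, opAt_eulerR, map_smul]
  rfl

theorem U0R_sub_constR_mem {k : ℕ} (V : Opens (N k)) (μ c : ℂ) :
    U0R V - constR V c ∈ spanR V (genJ k μ c) := by
  rw [U0R, constR, ← map_sub]
  exact diffRes_mem_spanR V (Or.inr rfl)

theorem mem_spanR_genJ_iff {k : ℕ} {V : Opens (N k)} {μ c : ℂ} {P : DiffOp V} :
    P ∈ spanR V (genJ k μ c) ↔
      ∃ v, P - v * (U0R V - constR V c) ∈ spanR V (genI k μ) := by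
  constructor
  · intro h
    rw [spanR, genJ, Set.image_union, Ideal.span_union, Set.image_singleton] at h
    obtain ⟨i, hi, j, hj, rfl⟩ := Submodule.mem_sup.1 h
    obtain ⟨v, rfl⟩ := Submodule.mem_span_singleton.1 hj
    refine ⟨v, ?_⟩
    rw [map_sub, smul_eq_mul, add_sub_cancel_right]
    exact hi
  · rintro ⟨v, hv⟩
    have h1 := add_mem (spanR_mono V (S' := genJ k μ c) Set.subset_union_left hv)
      (Ideal.mul_mem_left _ v (U0R_sub_constR_mem V μ c))
    rwa [sub_add_cancel] at h1

/-- Since U_0 - c multiplies c_n by n - c, the hypothesis says that P - v (U_0 - c) kills every c_n,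
hence lies in 𝓘_μ. The inclusions below are proved by exhibiting `v`. -/
theorem mem_spanR_genJ_of_traceValue {k : ℕ} {V : Opens (N k)} (hk : 0 < k) {μ : ℂ}
    (hμ : ∀ n : ℤ, μ ≠ n) {c : ℂ} {P : DiffOp V} (hP : P ∈ genSub V) (v : DiffOp V)
    (hv : v ∈ genSub V)
    (h : ∀ (z : V) (n : ℤ), traceValue μ z n P = (n - c) * traceValue μ z n v) :
    P ∈ spanR V (genJ k μ c) := by
  refine mem_spanR_genJ_iff.2 ⟨v, mem_spanR_genI_of_traceValue hk hμ
    (sub_mem hP (mul_mem hv (sub_mem (U0R_mem V) (constR_mem V c)))) fun z n => ?_⟩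
  rw [map_sub, h, mul_sub, map_sub, traceValue_mul_U0R, traceValue_mul_constR]
  ring

/-! ### Inclusions between the ideals, checked on the coefficients -/

section Inclusions

variable {k : ℕ} {V : Opens (N k)} {μ : ℂ}

theorem pdR_mem_genH {h : ℕ} (h1 : 1 ≤ h) (hk : h + 1 ≤ k) : pdR V h ∈ spanR V (genH k μ) :=
  diffRes_mem_spanR V (Or.inl ⟨h, h1, hk, rfl⟩)

theorem eulerR_mem_genH : eulerR V + constR V μ ∈ spanR V (genH k μ) := by
  rw [eulerR, constR, ← map_add]
  exact diffRes_mem_spanR V (Or.inr rfl)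

theorem genI_le_genH : spanR V (genI k μ) ≤ spanR V (genH k μ) := by
  refine Ideal.span_le.2 ?_
  rintro _ ⟨_, ⟨i, j, hi, hik, hj, hjk, rfl⟩ | ⟨m, hm, hmk, rfl⟩, rfl⟩
  · rw [A, map_sub, map_mul, map_mul, (pdR_comm V i j).eq]
    exact sub_mem (Ideal.mul_mem_left _ _ (pdR_mem_genH hi hik))
      (Ideal.mul_mem_left _ _ (pdR_mem_genH (by omega) (by omega)))
  · rw [T, map_add, map_mul, map_mul, map_add]
    exact add_mem (Ideal.mul_mem_left _ _ (pdR_mem_genH (by omega) (by omega)))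
      (Ideal.mul_mem_left _ _ eulerR_mem_genH)

theorem genI_subset_genSub {P : GlobalOps k} (hP : P ∈ genI k μ) : P ∈ genSub ⊤ := by
  obtain ⟨i, j, _, _, _, _, rfl⟩ | ⟨m, _, _, rfl⟩ := hP
  · exact sub_mem (mul_mem (pdR_mem ⊤ i) (pdR_mem ⊤ j))
      (mul_mem (pdR_mem ⊤ (i + 1)) (pdR_mem ⊤ (j - 1)))
  · exact add_mem (mul_mem (pdR_mem ⊤ 1) (pdR_mem ⊤ (m - 1)))
      (mul_mem (pdR_mem ⊤ m) (add_mem (eulerR_mem ⊤) (constR_mem ⊤ μ)))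

theorem pdR_mul_Um1R_mem (hμ : ∀ n : ℤ, μ ≠ n) {h : ℕ} (h1 : 1 ≤ h) (hk : h + 1 ≤ k) :
    pdR V h * Um1R V ∈ spanR V (genJ k μ (1 - k * μ)) := by
  refine mem_spanR_genJ_of_traceValue (by omega) hμ (mul_mem (pdR_mem V h) (Um1R_mem V))
    -- U_{-1} already produces the factor -(n - (1 - kμ)), and ∂_h c_{n-1} = ∂_{h+1} c_n.
    (-pdR V (h + 1)) (neg_mem (pdR_mem V _)) fun z n => ?_
  rw [traceValue_mul_Um1R, map_neg, traceValue_pdR μ z _ (Finset.mem_Icc.2 ⟨h1, by omega⟩),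
    traceValue_pdR μ z _ (Finset.mem_Icc.2 ⟨by omega, hk⟩),
    show n - 1 - (h : ℤ) = n - (h + 1 : ℕ) by push_cast; ring]
  ring

theorem eulerR_mul_Um1R_mem (hk : 0 < k) (hμ : ∀ n : ℤ, μ ≠ n) :
    (eulerR V + constR V μ) * Um1R V ∈ spanR V (genJ k μ (1 - k * μ)) := by
  refine mem_spanR_genJ_of_traceValue hk hμ
    (mul_mem (add_mem (eulerR_mem V) (constR_mem V μ)) (Um1R_mem V))
    (pdR V 1) (pdR_mem V _) fun z n => ?_
  rw [traceValue_mul_Um1R, traceValue_eulerR, traceValue_pdR μ z _ (Finset.mem_Icc.2 ⟨le_rfl, hk⟩)]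
  push_cast
  ring

/-- U_{-1} sends c_n to a multiple of c_{n-1}, so right multiplication by it preserves the
annihilator of all the c_n; hence `v = 0`. -/
theorem mul_Um1R_mem_of_mem_genI (hk : 0 < k) (hμ : ∀ n : ℤ, μ ≠ n) (c : ℂ) {P : DiffOp V}
    (hP : P ∈ genSub V) (h : P ∈ spanR V (genI k μ)) : P * Um1R V ∈ spanR V (genJ k μ c) := by
  refine mem_spanR_genJ_of_traceValue hk hμ (mul_mem hP (Um1R_mem V)) 0 (zero_mem _) fun z n => ?_
  rw [traceValue_mul_Um1R, traceValue_eq_zero_of_mem_spanR h, map_zero, mul_zero, mul_zero]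

theorem mul_U1μR_mem_of_mem_genI (hk : 0 < k) (hμ : ∀ n : ℤ, μ ≠ n) (c : ℂ) {P : DiffOp V}
    (hP : P ∈ genSub V) (h : P ∈ spanR V (genI k μ)) : P * U1μR V μ ∈ spanR V (genJ k μ c) := by
  refine mem_spanR_genJ_of_traceValue hk hμ (mul_mem hP (U1μR_mem V μ)) 0 (zero_mem _)
    fun z n => ?_
  rw [traceValue_mul_U1μR, traceValue_eq_zero_of_mem_spanR h, map_zero, mul_zero, mul_zero]

theorem traceValue_U0R_sub (z : V) (n : ℤ) (c : ℂ) :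
    traceValue μ z n (U0R V - constR V c) = (n - c) * traceValue μ z n 1 := by
  rw [← one_mul (U0R V - constR V c), mul_sub, map_sub, traceValue_mul_U0R, traceValue_mul_constR]
  ring

theorem traceValue_Um1R (z : V) (n : ℤ) :
    traceValue μ z n (Um1R V) = -(n - 1 + k * μ) * traceValue μ z (n - 1) 1 := by
  rw [← one_mul (Um1R V), traceValue_mul_Um1R]

theorem traceValue_U1μR (z : V) (n : ℤ) :
    traceValue μ z n (U1μR V μ) = -(n + 1) * traceValue μ z (n + 1) 1 := by
  rw [← one_mul (U1μR V μ), traceValue_mul_U1μR]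

/-- U_1 + μσ_1 raises the U_0-eigenvalue by one, so U_0 - (1 - kμ) on the left becomes U_0 + kμ on
the right. -/
theorem U0R_sub_mul_U1μR_mem (hk : 0 < k) (hμ : ∀ n : ℤ, μ ≠ n) :
    (U0R V - constR V (1 - k * μ)) * U1μR V μ ∈ spanR V (genJ k μ (-(k * μ))) := by
  refine mem_spanR_genJ_of_traceValue hk hμ
    (mul_mem (sub_mem (U0R_mem V) (constR_mem V _)) (U1μR_mem V μ)) (U1μR V μ) (U1μR_mem V μ)
    fun z n => ?_
  rw [traceValue_mul_U1μR, traceValue_U0R_sub, traceValue_U1μR]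
  push_cast
  ring

theorem U0R_sub_mul_Um1R_mem (hk : 0 < k) (hμ : ∀ n : ℤ, μ ≠ n) :
    (U0R V - constR V (-(k * μ))) * Um1R V ∈ spanR V (genJ k μ (1 - k * μ)) := by
  refine mem_spanR_genJ_of_traceValue hk hμ
    (mul_mem (sub_mem (U0R_mem V) (constR_mem V _)) (Um1R_mem V)) (Um1R V) (Um1R_mem V)
    fun z n => ?_
  rw [traceValue_mul_Um1R, traceValue_U0R_sub, traceValue_Um1R]
  push_cast
  ring

theorem Um1R_mul_U1μR_mem (hk : 0 < k) (hμ : ∀ n : ℤ, μ ≠ n) :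
    Um1R V * U1μR V μ ∈ spanR V (genJ k μ (-(k * μ))) := by
  refine mem_spanR_genJ_of_traceValue hk hμ (mul_mem (Um1R_mem V) (U1μR_mem V μ))
    -- The product multiplies c_n by (n + 1)(n + kμ), so `v` is U_0 + 1.
    (U0R V - constR V (-1)) (sub_mem (U0R_mem V) (constR_mem V _)) fun z n => ?_
  rw [traceValue_mul_U1μR, traceValue_Um1R, traceValue_U0R_sub, add_sub_cancel_right]
  push_cast
  ring

/-- U_1 + μσ_1 = σ_1 (E + μ) - Σ (h + 1) σ_{h+1} ∂_h, and the only term with ∂_k carries σ_{k+1} =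
0. -/
theorem U1μR_mem_genH : U1μR V μ ∈ spanR V (genH k μ) := by
  have h1 : U1μR V μ = mulHom V (coord V 1) * (eulerR V + constR V μ) - ∑ h ∈ Finset.Icc 1 k,
      mulHom V (algebraMap ℂ (holo V) (h + 1) * coord V (h + 1)) * pdR V h := by
    rw [U1μR_eq, eulerR_eq, mul_add, Finset.mul_sum, constR, diffRes_const, ← map_mul,
      mul_comm (coord V 1), add_sub_right_comm, ← Finset.sum_sub_distrib]
    congr 1
    refine Finset.sum_congr rfl fun h _ => ?_
    rw [map_sub, sub_mul, map_mul (mulHom V) (coord V 1), mul_assoc]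
  rw [h1]
  refine sub_mem (Ideal.mul_mem_left _ _ eulerR_mem_genH) (sum_mem fun h hh => ?_)
  rw [Finset.mem_Icc] at hh
  by_cases hk : h + 1 ≤ k
  · exact Ideal.mul_mem_left _ _ (pdR_mem_genH hh.1 hk)
  · have h2 : coord V (h + 1) = 0 := holo_ext fun w =>
      coordFun_of_lt (h := h + 1) (by omega) w
    rw [h2, mul_zero, map_zero, zero_mul]
    exact zero_mem _

theorem mem_of_constR_mul_mem {c : ℂ} (hc : c ≠ 0) {S : Ideal (DiffOp V)} {P : DiffOp V}
    (h : constR V c * P ∈ S) : P ∈ S := by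
  have h1 := Ideal.mul_mem_left S (constR V c⁻¹) h
  have h2 : constR V c⁻¹ * (constR V c * P) = P := by
    refine diffOp_ext fun z u => ?_
    rw [map_mul, map_mul, Module.End.mul_apply, Module.End.mul_apply, opAt_constR, opAt_constR,
      inv_smul_smul₀ hc]
  rwa [h2] at h1

theorem mem_genJ_union_of_add_mul_mem {c d : ℂ} (hc : c ≠ 0) {Y : GlobalOps k} {P Q : DiffOp V}
    (h : constR V c * P + Q * diffRes le_top Y ∈ spanR V (genJ k μ d)) :
    P ∈ spanR V (genJ k μ d ∪ {Y}) := by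
  refine mem_of_constR_mul_mem hc ?_
  have h1 := sub_mem (spanR_mono V (S' := genJ k μ d ∪ {Y}) Set.subset_union_left h)
    (Ideal.mul_mem_left _ Q (diffRes_mem_spanR V (S := genJ k μ d ∪ {Y}) (Or.inr rfl)))
  rwa [add_sub_cancel_right] at h1

/-- As ∂_{h+1} c_{n+1} = ∂_h c_n, the operator (1 - kμ) ∂_h + ∂_{h+1} (U_1 + μσ_1) acts on c_n as
-(n + kμ) ∂_h. -/
theorem pdR_mem_genJ_union (hμ : ∀ n : ℤ, μ ≠ n) (hkμ : (k : ℂ) * μ ≠ 1) {h : ℕ} (h1 : 1 ≤ h)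
    (hk : h + 1 ≤ k) : pdR V h ∈ spanR V (genJ k μ (-(k * μ)) ∪ {U1μ k μ}) := by
  refine mem_genJ_union_of_add_mul_mem (c := 1 - k * μ) (Q := pdR V (h + 1))
    (sub_ne_zero.2 hkμ.symm) (mem_spanR_genJ_of_traceValue (by omega) hμ
      (add_mem (mul_mem (constR_mem V _) (pdR_mem V h)) (mul_mem (pdR_mem V _) (U1μR_mem V μ)))
      (-pdR V h) (neg_mem (pdR_mem V h)) fun z n => ?_)
  rw [map_add, map_neg, traceValue_constR_mul, traceValue_mul_U1μR,
    traceValue_pdR μ z _ (Finset.mem_Icc.2 ⟨h1, by omega⟩),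
    traceValue_pdR μ z _ (Finset.mem_Icc.2 ⟨by omega, hk⟩),
    show n + 1 - (h + 1 : ℕ) = n - h by push_cast; ring]
  ring

/-- Here the correction is -∂_1 (U_1 + μσ_1), because ∂_1 c_{n+1} = -(E + μ) c_n. -/
theorem eulerR_mem_genJ_union (hk : 0 < k) (hμ : ∀ n : ℤ, μ ≠ n) (hkμ : (k : ℂ) * μ ≠ 1) :
    eulerR V + constR V μ ∈ spanR V (genJ k μ (-(k * μ)) ∪ {U1μ k μ}) := by
  refine mem_genJ_union_of_add_mul_mem (c := 1 - k * μ) (Q := -pdR V 1)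
    (sub_ne_zero.2 hkμ.symm) (mem_spanR_genJ_of_traceValue hk hμ
      (add_mem (mul_mem (constR_mem V _) (add_mem (eulerR_mem V) (constR_mem V μ)))
        (mul_mem (neg_mem (pdR_mem V _)) (U1μR_mem V μ)))
      (-(eulerR V + constR V μ)) (neg_mem (add_mem (eulerR_mem V) (constR_mem V μ))) fun z n => ?_)
  rw [map_add, map_neg, traceValue_constR_mul, traceValue_mul_U1μR, traceValue_eulerR, map_neg,
    traceValue_pdR μ z _ (Finset.mem_Icc.2 ⟨le_rfl, hk⟩), Nat.cast_one, add_sub_cancel_right]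
  ring

end Inclusions

/-! ### The kernel of the right multiplication by `U_1 + μ σ_1` -/

theorem exists_diffRes_mem_genSub {k : ℕ} {U : Opens (N k)} (P : DiffOp U) (z : U) :
    ∃ (V : Opens (N k)) (_ : z.1 ∈ V) (h : V ≤ U), diffRes h P ∈ genSub V := by
  obtain ⟨V, hV, i, h⟩ := P.2 z
  exact ⟨V, hV, i.le, h⟩

/-- Locally, if the product `Q X` belongs to the ideal `𝓙_{μ,c}`, this can be expressed by operators
that are finite sums of `f ∂^α`. -/
theorem exists_mul_sub_mem {k : ℕ} {μ c : ℂ} {U : Opens (N k)} {Q : DiffOp U} {X : GlobalOps k}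
    (h : Q * diffRes le_top X ∈ localIdeal (genJ k μ c) U) (z : U) :
    ∃ (V : Opens (N k)) (_ : z.1 ∈ V) (i : V ≤ U) (v : DiffOp V), diffRes i Q ∈ genSub V ∧
      v ∈ genSub V ∧ diffRes i Q * diffRes le_top X - v * (U0R V - constR V c) ∈
        spanR V (genI k μ) := by
  obtain ⟨V₁, hV₁, i₁, h₁⟩ := h z
  obtain ⟨v, hv⟩ := mem_spanR_genJ_iff.1 h₁
  obtain ⟨V₂, hV₂, i₂, h₂⟩ := exists_diffRes_mem_genSub Q z
  obtain ⟨V₃, hV₃, i₃, h₃⟩ := exists_diffRes_mem_genSub v ⟨z.1, hV₁⟩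
  refine ⟨V₂ ⊓ V₃, ⟨hV₂, hV₃⟩, inf_le_left.trans i₂, diffRes (inf_le_right.trans i₃) v,
    diffRes_mem_genSub inf_le_left h₂, diffRes_mem_genSub inf_le_right h₃, ?_⟩
  have h4 := span_res (genI k μ) (inf_le_right.trans i₃ : V₂ ⊓ V₃ ≤ V₁) hv
  rw [map_sub, map_mul, map_mul, map_mul, map_sub] at h4
  exact h4

/-- The hypothesis yields -(n + 1) Q c_{n+1} = (n + kμ) v c_n. After shifting n, (1 - kμ) Q - v
U_{-1} acts on c_n as -(n - (1 - kμ)) Q, so it lies in 𝓙_{μ,1-kμ}. -/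
theorem mem_localIdeal_of_mul_U1μ {k : ℕ} (hk : 0 < k) {μ : ℂ} (hμ : ∀ n : ℤ, μ ≠ n)
    (hkμ : (k : ℂ) * μ ≠ 1) (U : Opens (N k)) (Q : DiffOp U)
    (h : Q * diffRes le_top (U1μ k μ) ∈ localIdeal (genJ k μ (-(k * μ))) U) :
    Q ∈ localIdeal (genJ k μ (1 - k * μ) ∪ {Um1 k}) U := by
  intro z
  obtain ⟨V, hV, i, v, hQ, hv, hI⟩ := exists_mul_sub_mem h z
  refine ⟨V, hV, i, ?_⟩
  have key : ∀ (z : V) (n : ℤ), -(n + 1 : ℂ) * traceValue μ z (n + 1) (diffRes i Q) =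
      (n + k * μ) * traceValue μ z n v := by
    intro z n
    have h1 := traceValue_eq_zero_of_mem_spanR hI z n
    rw [map_sub, traceValue_mul_U1μR, mul_sub, map_sub, traceValue_mul_U0R,
      traceValue_mul_constR] at h1
    linear_combination h1
  refine mem_genJ_union_of_add_mul_mem (c := 1 - k * μ) (Q := -v) (sub_ne_zero.2 hkμ.symm)
    (mem_spanR_genJ_of_traceValue hk hμ
      (add_mem (mul_mem (constR_mem V _) hQ) (mul_mem (neg_mem hv) (Um1R_mem V)))
      (-diffRes i Q) (neg_mem hQ) fun z n => ?_)
  have h1 := key z (n - 1)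
  rw [sub_add_cancel] at h1
  push_cast at h1
  rw [map_add, map_neg, traceValue_constR_mul, traceValue_mul_Um1R, map_neg]
  linear_combination -h1

/-! ### The generating series of the coefficients -/

/-- The polynomial `1 + σ_1 t + ⋯ + σ_k t^k`. -/
def symPoly (k : ℕ) (w : Fin k → ℂ) : Polynomial ℂ :=
  ∑ h ∈ Finset.range (k + 1), Polynomial.monomial h (coordFun k h w)

/-- The power series `(1 + σ_1 t + ⋯ + σ_k t^k)^(-x)`. -/
def traceSeries (k : ℕ) (x : ℂ) (w : Fin k → ℂ) : PowerSeries ℂ :=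
  PowerSeries.mk fun n => traceCoeff k x n w

theorem natDegree_symPoly_le (k : ℕ) (w : Fin k → ℂ) : (symPoly k w).natDegree ≤ k :=
  Polynomial.natDegree_sum_le_of_forall_le _ _ fun h hh =>
    (Polynomial.natDegree_monomial_le _).trans (by rw [Finset.mem_range] at hh; omega)

theorem coeff_symPoly (k : ℕ) (w : Fin k → ℂ) : (symPoly k w).coeff k = coordFun k k w := by
  simp [symPoly, Polynomial.coeff_monomial]

theorem coeff_monomial_mul {n h : ℕ} (c : ℂ) (k : ℕ) (x : ℂ) (w : Fin k → ℂ) :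
    PowerSeries.coeff n ((Polynomial.monomial h c : PowerSeries ℂ) * traceSeries k x w) =
      c * traceCoeff k x (n - h) w := by
  rw [← Polynomial.C_mul_X_pow_eq_monomial, Polynomial.coe_mul, Polynomial.coe_C, Polynomial.coe_pow,
    Polynomial.coe_X, mul_assoc, PowerSeries.coeff_C_mul, PowerSeries.coeff_X_pow_mul']
  split_ifs with hn
  · rw [traceSeries, PowerSeries.coeff_mk, Nat.cast_sub hn]
  · rw [traceCoeff_of_neg (by omega)]

theorem symPoly_mul_traceSeries (k : ℕ) (x : ℂ) (w : Fin k → ℂ) :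
    (symPoly k w : PowerSeries ℂ) * traceSeries k (x + 1) w = traceSeries k x w := by
  ext n
  rw [symPoly, ← Polynomial.coeToPowerSeries.ringHom_apply, map_sum, Finset.sum_mul, map_sum]
  simp only [Polynomial.coeToPowerSeries.ringHom_apply, coeff_monomial_mul]
  rw [sum_range_succ_eq_add_sum_Icc, coordFun_zero, one_mul, Nat.cast_zero, sub_zero,
    sum_coordFun_mul_traceCoeff, traceSeries, PowerSeries.coeff_mk]

theorem symPoly_pow_mul_traceSeries (k : ℕ) (x : ℂ) (j : ℕ) (w : Fin k → ℂ) :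
    ((symPoly k w ^ j : Polynomial ℂ) : PowerSeries ℂ) * traceSeries k (x + j) w =
      traceSeries k x w := by
  induction j with
  | zero => simp
  | succ j ih =>
    rw [pow_succ, Polynomial.coe_mul, mul_assoc, Nat.cast_succ, ← add_assoc,
      symPoly_mul_traceSeries, ih]

theorem X_mul_derivative_symPoly (k : ℕ) (w : Fin k → ℂ) :
    Polynomial.X * Polynomial.derivative (symPoly k w) =
      ∑ h ∈ Finset.range (k + 1), Polynomial.monomial h ((h : ℂ) * coordFun k h w) := by
  rw [symPoly, Polynomial.derivative_sum, Finset.mul_sum]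
  refine Finset.sum_congr rfl fun h _ => ?_
  rw [Polynomial.derivative_monomial]
  cases h with
  | zero => simp
  | succ h => rw [Nat.add_sub_cancel, Polynomial.X_mul_monomial, mul_comm]

open PowerSeries in
-- The differential equation S t F' = -x t S' F for F = S^(-x); it avoids exponentials and
-- logarithms.
theorem symPoly_mul_X_mul_derivative (k : ℕ) (x : ℂ) (w : Fin k → ℂ) :
    (symPoly k w : PowerSeries ℂ) * (X * d⁄dX ℂ (traceSeries k x w)) =
      C (-x) * ((X * d⁄dX ℂ (symPoly k w : PowerSeries ℂ)) * traceSeries k x w) := by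
  have h1 : X * d⁄dX ℂ (traceSeries k x w) =
      C (-x) * ((X * d⁄dX ℂ (symPoly k w : PowerSeries ℂ)) * traceSeries k (x + 1) w) := by
    ext n
    rw [derivative_coe, ← Polynomial.coe_X, ← Polynomial.coe_mul, X_mul_derivative_symPoly,
      Polynomial.coe_X, ← Polynomial.coeToPowerSeries.ringHom_apply, map_sum, Finset.sum_mul,
      coeff_C_mul, map_sum]
    simp only [Polynomial.coeToPowerSeries.ringHom_apply, coeff_monomial_mul]
    rw [sum_range_succ_eq_add_sum_Icc, Nat.cast_zero, zero_mul, zero_mul, zero_add, Finset.mul_sum]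
    have h2 : coeff n (X * d⁄dX ℂ (traceSeries k x w)) = n * traceCoeff k x n w := by
      cases n with
      | zero => simp
      | succ n =>
        rw [coeff_succ_X_mul, coeff_derivative, traceSeries, coeff_mk]
        push_cast
        ring
    have h3 := sum_mul_coordFun_mul_traceCoeff k x n w
    rw [Int.cast_natCast] at h3
    rw [h2, ← h3]
    exact Finset.sum_congr rfl fun h _ => by ring
  rw [h1, ← symPoly_mul_traceSeries k x w]
  ring

theorem symPoly_ne_zero (k : ℕ) (w : Fin k → ℂ) : (symPoly k w : PowerSeries ℂ) ≠ 0 := by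
  intro h
  have h1 := symPoly_mul_traceSeries k 0 w
  rw [h, zero_mul] at h1
  have h2 := congrArg (PowerSeries.coeff 0) h1
  rw [traceSeries, PowerSeries.coeff_mk, Nat.cast_zero, traceCoeff_zero, map_zero] at h2
  exact zero_ne_one h2

open PowerSeries in
-- By the two differential equations the product has zero derivative, after cancelling S and t; its
-- constant term is 1.
theorem traceSeries_mul_traceSeries_neg (k : ℕ) (x : ℂ) (w : Fin k → ℂ) :
    traceSeries k x w * traceSeries k (-x) w = 1 := by
  apply derivative.ext
  · apply mul_left_cancel₀ (mul_ne_zero (symPoly_ne_zero k w) X_ne_zero)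
    have h1 := symPoly_mul_X_mul_derivative k x w
    have h2 := symPoly_mul_X_mul_derivative k (-x) w
    rw [derivative_one, mul_zero, Derivation.leibniz, smul_eq_mul, smul_eq_mul]
    rw [neg_neg, map_neg] at *
    linear_combination traceSeries k (-x) w * h1 + traceSeries k x w * h2
  · rw [map_mul, ← coeff_zero_eq_constantCoeff_apply, ← coeff_zero_eq_constantCoeff_apply,
      traceSeries, traceSeries, coeff_mk, coeff_mk, Nat.cast_zero, traceCoeff_zero, traceCoeff_zero,
      mul_one, map_one]

/-! ### The kernel of the right multiplication by `U_{-1}` -/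

theorem le_mul_monomialOrder {k : ℕ} (hk : 0 < k) (m : ℕ) : m ≤ k * monomialOrder k m := by
  cases m with
  | zero => exact Nat.zero_le _
  | succ m => exact Nat.lt_mul_div_succ m hk

theorem monomialOrder_le_of_le {k m n : ℕ} (h : m ≤ k * n) : monomialOrder k m ≤ n := by
  cases m with
  | zero => exact Nat.zero_le _
  | succ m => exact Nat.div_lt_of_lt_mul h

theorem monomialOrder_mul {k : ℕ} (hk : 0 < k) (j : ℕ) : monomialOrder k (k * j) = j := by
  cases j with
  | zero => rfl
  | succ j =>
    obtain ⟨l, rfl⟩ : ∃ l, k = l + 1 := ⟨k - 1, by omega⟩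
    rw [show (l + 1) * (j + 1) = (l + (l + 1) * j) + 1 by ring, monomialOrder,
      Nat.add_mul_div_left _ _ hk, Nat.div_eq_of_lt (by omega), zero_add]

theorem monomialR_mul {k : ℕ} (V : Opens (N k)) (hk : 0 < k) (j : ℕ) :
    monomialR V (k * j) = pdR V k ^ j := by
  cases j with
  | zero => rfl
  | succ j =>
    rw [pow_succ, pow_mul_pdR_eq_monomialR V j hk le_rfl]
    congr 1
    rw [mul_add, mul_one, add_assoc, Nat.sub_add_cancel hk, mul_comm]

/-- If k does not divide m, the last factor of the monomial is some ∂_r with r < k. -/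
theorem monomialR_mem_genH {k : ℕ} {V : Opens (N k)} {μ : ℂ} {m : ℕ} (hk : 0 < k)
    (hm : ¬ k ∣ m) : monomialR V m ∈ spanR V (genH k μ) := by
  cases m with
  | zero => exact absurd (dvd_zero k) hm
  | succ m =>
    refine Ideal.mul_mem_left _ _ (pdR_mem_genH (by omega) ?_)
    by_contra h
    have h1 := Nat.mod_lt m hk
    have h2 := Nat.div_add_mod m k
    exact hm ⟨m / k + 1, by rw [mul_add]; omega⟩

/-- The polynomial `α` such that `α (1 + σ_1 t + ⋯ + σ_k t^k)^(-μ - n)` is the generating series of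
the values of `monomialSum V f`. -/
def numerator {k : ℕ} {V : Opens (N k)} (μ : ℂ) (n : ℕ) (f : ℕ →₀ holo V) (w : Fin k → ℂ) :
    Polynomial ℂ :=
  ∑ m ∈ Finset.range (k * n + 1),
    Polynomial.monomial m ((f m).1 w * descProd μ (monomialOrder k m)) *
      symPoly k w ^ (n - monomialOrder k m)

/-- A monomial of order o has weight m ≤ k o, so its term has degree at most m + k (n - o) ≤ k n. -/
theorem natDegree_numerator_le {k : ℕ} (hk : 0 < k) {V : Opens (N k)} (μ : ℂ) (n : ℕ)
    (f : ℕ →₀ holo V) (w : Fin k → ℂ) : (numerator μ n f w).natDegree ≤ k * n := by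
  refine Polynomial.natDegree_sum_le_of_forall_le _ _ fun m hm => ?_
  rw [Finset.mem_range] at hm
  have ho : monomialOrder k m ≤ n := monomialOrder_le_of_le (by omega)
  refine Polynomial.natDegree_mul_le.trans ((add_le_add (Polynomial.natDegree_monomial_le _)
    (Polynomial.natDegree_pow_le_of_le _ (natDegree_symPoly_le k w))).trans ?_)
  have h1 := le_mul_monomialOrder hk m
  calc m + (n - monomialOrder k m) * k
      ≤ k * monomialOrder k m + (n - monomialOrder k m) * k := by gcongr
    _ = k * n := by rw [mul_comm _ k, ← mul_add, Nat.add_sub_cancel' ho]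

/-- Degree k n is reached only when m is k times the order, that is, for the pure powers ∂_k^j;
these contribute the leading coefficient σ_k^(n-j) of S^(n-j). -/
theorem coeff_numerator {k : ℕ} (hk : 0 < k) {V : Opens (N k)} (μ : ℂ) (n : ℕ)
    (f : ℕ →₀ holo V) (w : Fin k → ℂ) : (numerator μ n f w).coeff (k * n) =
      ∑ j ∈ Finset.range (n + 1),
        (f (k * j)).1 w * descProd μ j * coordFun k k w ^ (n - j) := by
  have hterm : ∀ m ≤ k * n, (Polynomial.monomial m ((f m).1 w * descProd μ (monomialOrder k m)) *
      symPoly k w ^ (n - monomialOrder k m)).coeff (k * n) =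
      (f m).1 w * descProd μ (monomialOrder k m) *
        (symPoly k w ^ (n - monomialOrder k m)).coeff (k * n - m) := by
    intro m hm
    rw [← Polynomial.C_mul_X_pow_eq_monomial, mul_assoc, Polynomial.coeff_C_mul,
      Polynomial.coeff_X_pow_mul', if_pos hm]
  have himage : ∑ j ∈ Finset.range (n + 1),
        (f (k * j)).1 w * descProd μ j * coordFun k k w ^ (n - j) =
      ∑ m ∈ (Finset.range (n + 1)).image (k * ·), (Polynomial.monomial m
        ((f m).1 w * descProd μ (monomialOrder k m)) *
          symPoly k w ^ (n - monomialOrder k m)).coeff (k * n) := by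
    rw [Finset.sum_image fun a _ b _ h => Nat.eq_of_mul_eq_mul_left hk h]
    refine Finset.sum_congr rfl fun j hj => ?_
    rw [Finset.mem_range] at hj
    rw [hterm _ (Nat.mul_le_mul_left k (by omega)), monomialOrder_mul hk, ← Nat.mul_sub,
      mul_comm k (n - j), Polynomial.coeff_pow_of_natDegree_le (natDegree_symPoly_le k w),
      coeff_symPoly]
  rw [himage, numerator, Polynomial.finsetSum_coeff]
  refine (Finset.sum_subset ?_ fun m hm hm' => ?_).symm
  · intro m hm
    obtain ⟨j, hj, rfl⟩ := Finset.mem_image.1 hm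
    rw [Finset.mem_range] at hj ⊢
    exact Nat.lt_succ_of_le (Nat.mul_le_mul_left k (by omega))
  · rw [Finset.mem_range] at hm
    have ho : monomialOrder k m ≤ n := monomialOrder_le_of_le (by omega)
    rw [hterm m (by omega), Polynomial.coeff_eq_zero_of_natDegree_lt, mul_zero]
    refine (Polynomial.natDegree_pow_le_of_le _ (natDegree_symPoly_le k w)).trans_lt ?_
    have h1 : m ≠ k * monomialOrder k m := fun h =>
      hm' (Finset.mem_image.2 ⟨monomialOrder k m, Finset.mem_range.2 (by omega), h.symm⟩)
    have h2 := le_mul_monomialOrder hk m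
    have h3 : k * monomialOrder k m ≤ k * n := Nat.mul_le_mul_left k ho
    rw [mul_comm, Nat.mul_sub]
    omega

/-- Each monomial of order o contributes a multiple of t^m S^(-μ-o), and S^(n-o) brings all of them
to the common power S^(-μ-n). -/
theorem mk_traceValue_monomialSum {k : ℕ} (hk : 0 < k) {V : Opens (N k)} (μ : ℂ) {n : ℕ}
    (f : ℕ →₀ holo V) (hf : ∀ m ∈ f.support, m ≤ k * n) (z : V) :
    PowerSeries.mk (fun i : ℕ => traceValue μ z i (monomialSum V f)) =
      (numerator μ n f z.1 : PowerSeries ℂ) * traceSeries k (μ + n) z.1 := by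
  ext i
  rw [PowerSeries.coeff_mk, traceValue_monomialSum hk, numerator,
    ← Polynomial.coeToPowerSeries.ringHom_apply, map_sum, Finset.sum_mul, map_sum]
  have h1 : ∀ m ∈ Finset.range (k * n + 1), PowerSeries.coeff i (Polynomial.coeToPowerSeries.ringHom
      (Polynomial.monomial m ((f m).1 z.1 * descProd μ (monomialOrder k m)) *
        symPoly k z.1 ^ (n - monomialOrder k m)) * traceSeries k (μ + n) z.1) =
      (f m).1 z.1 * (descProd μ (monomialOrder k m) *
        traceCoeff k (μ + monomialOrder k m) (i - m) z.1) := by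
    intro m hm
    rw [Finset.mem_range] at hm
    have ho : monomialOrder k m ≤ n := monomialOrder_le_of_le (by omega)
    have h2 := symPoly_pow_mul_traceSeries k (μ + monomialOrder k m) (n - monomialOrder k m) z.1
    rw [Nat.cast_sub ho, add_add_sub_cancel] at h2
    rw [Polynomial.coeToPowerSeries.ringHom_apply, Polynomial.coe_mul, mul_assoc, h2,
      coeff_monomial_mul, mul_assoc]
  rw [Finset.sum_congr rfl h1]
  refine Finset.sum_subset (fun m hm => Finset.mem_range.2 (Nat.lt_succ_of_le (hf m hm)))
    fun m _ hm => ?_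
  rw [Finsupp.notMem_support_iff.1 hm]
  exact zero_mul _

theorem continuous_traceValue_monomialSum {k : ℕ} (hk : 0 < k) {V : Opens (N k)} (μ : ℂ) (n : ℤ)
    (f : ℕ →₀ holo V) : Continuous fun z : V => traceValue μ z n (monomialSum V f) := by
  simp only [traceValue_monomialSum hk]
  refine continuous_finsetSum _ fun m _ => ?_
  have h1 : Continuous fun z : V => (f m).1 z.1 :=
    continuousOn_iff_continuous_domRestrict.1 (f m).2.continuousOn
  have h2 : Continuous fun z : V => traceCoeff k (μ + monomialOrder k m) (n - m) z.1 :=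
    continuousOn_iff_continuous_domRestrict.1 (traceCoeff_analytic k _ _ V).continuousOn
  exact h1.mul (continuous_const.mul h2)

/-- Moving ∂_k^n across E + μ gives (E + μ + n) ∂_k^n, and only the term σ_k ∂_k of E survives
modulo ∂_1, …, ∂_{k-1}. -/
theorem coord_mul_pow_add_mem_genH {k : ℕ} (hk : 0 < k) (V : Opens (N k)) (μ : ℂ) (n : ℕ) :
    mulHom V (coord V k) * pdR V k ^ (n + 1) + constR V (μ + n) * pdR V k ^ n ∈
      spanR V (genH k μ) := by
  have hk1 : k ∈ Finset.Icc 1 k := Finset.mem_Icc.2 ⟨hk, le_rfl⟩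
  have h1 : pdR V k ^ n * (eulerR V + constR V μ) ∈ spanR V (genH k μ) :=
    Ideal.mul_mem_left _ _ eulerR_mem_genH
  have h2 : ∑ h ∈ Finset.Icc 1 (k - 1), mulHom V (coord V h) * pdR V h * pdR V k ^ n ∈
      spanR V (genH k μ) := sum_mem fun h hh => by
    rw [Finset.mem_Icc] at hh
    rw [mul_assoc, ((pdR_comm V h k).pow_right n).eq]
    exact Ideal.mul_mem_left _ _ (Ideal.mul_mem_left _ _ (pdR_mem_genH hh.1 (by omega)))
  have h3 : ∑ h ∈ Finset.Icc 1 k, mulHom V (coord V h) * pdR V h * pdR V k ^ n =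
      ∑ h ∈ Finset.Icc 1 (k - 1), mulHom V (coord V h) * pdR V h * pdR V k ^ n +
        mulHom V (coord V k) * pdR V k ^ (n + 1) := by
    obtain ⟨l, rfl⟩ : ∃ l, k = l + 1 := ⟨k - 1, by omega⟩
    rw [Finset.sum_Icc_succ_top (by omega), Nat.add_sub_cancel, pow_succ', mul_assoc (mulHom V _)]
  have h4 := sub_mem h1 h2
  rw [mul_add, pdR_pow_mul_eulerR V hk1, add_mul, eulerR_eq, Finset.sum_mul, h3,
    ← ((constR_comm_pdR V μ k).pow_right n).eq] at h4
  convert h4 using 1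
  rw [constR_add, constR_natCast]
  noncomm_ring

/-- The hypothesis makes the top coefficient divisible by σ_k on `V`, so σ_k ∂_k^(n+1) ≡ -(μ + n)
∂_k^n lowers the degree; the relation `ha` passes to the new coefficients. -/
theorem sum_mul_pow_mem_genH {k : ℕ} (hk : 0 < k) {V : Opens (N k)} {μ : ℂ} (hμ : ∀ n : ℤ, μ ≠ n)
    (n : ℕ) (a : ℕ → holo V)
    (ha : ∀ z : V, ∑ j ∈ Finset.range (n + 1),
      (a j).1 z.1 * descProd μ j * coordFun k k z.1 ^ (n - j) = 0) :
    ∑ j ∈ Finset.range (n + 1), mulHom V (a j) * pdR V k ^ j ∈ spanR V (genH k μ) := by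
  induction n generalizing a with
  | zero =>
    have h1 : mulHom V (a 0) = 0 := mulHom_eq_zero fun z => by simpa [descProd] using ha z
    simp [h1]
  | succ n ih =>
    have hd := descProd_ne_zero hμ (n + 1)
    -- `g` is the quotient of the top coefficient by σ_k, read off by solving `ha` for it.
    obtain ⟨g, hg⟩ : ∃ g : holo V, ∀ w, g.1 w = -(descProd μ (n + 1))⁻¹ *
        ∑ j ∈ Finset.range (n + 1), (a j).1 w * descProd μ j * coordFun k k w ^ (n - j) := by
      refine ⟨algebraMap ℂ (holo V) (-(descProd μ (n + 1))⁻¹) * ∑ j ∈ Finset.range (n + 1),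
        a j * algebraMap ℂ (holo V) (descProd μ j) * coord V k ^ (n - j), fun w => ?_⟩
      change -(descProd μ (n + 1))⁻¹ * (∑ j ∈ Finset.range (n + 1),
        a j * algebraMap ℂ (holo V) (descProd μ j) * coord V k ^ (n - j) : holo V).1 w = _
      rw [holo_sum_apply]
      rfl
    have hlast : mulHom V (a (n + 1)) = mulHom V g * mulHom V (coord V k) := by
      rw [← map_mul, ← sub_eq_zero, ← map_sub]
      refine mulHom_eq_zero fun z => ?_
      have h1 := ha z
      rw [Finset.sum_range_succ, Nat.sub_self, pow_zero, mul_one] at h1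
      have h2 : ∑ j ∈ Finset.range (n + 1),
          (a j).1 z.1 * descProd μ j * coordFun k k z.1 ^ (n + 1 - j) =
          (∑ j ∈ Finset.range (n + 1),
            (a j).1 z.1 * descProd μ j * coordFun k k z.1 ^ (n - j)) * coordFun k k z.1 := by
        rw [Finset.sum_mul]
        refine Finset.sum_congr rfl fun j hj => ?_
        rw [Finset.mem_range] at hj
        rw [show n + 1 - j = n - j + 1 by omega, pow_succ]
        ring
      rw [h2] at h1
      change (a (n + 1)).1 z.1 - g.1 z.1 * coordFun k k z.1 = 0
      rw [hg]
      field_simp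
      linear_combination h1
    let a' : ℕ → holo V := fun j =>
      if j = n then a n - algebraMap ℂ (holo V) (μ + n) * g else a j
    have hne : ∀ j ∈ Finset.range n, a' j = a j := fun j hj =>
      if_neg (Finset.mem_range.1 hj).ne
    have hn : a' n = a n - algebraMap ℂ (holo V) (μ + n) * g := if_pos rfl
    have h1 := ih a' fun z => by
      have h2 := hg z.1
      rw [Finset.sum_range_succ, Nat.sub_self, pow_zero, mul_one] at h2 ⊢
      rw [Finset.sum_congr rfl fun j hj => by rw [hne j hj], hn]
      change _ + ((a n).1 z.1 - (μ + n) * g.1 z.1) * descProd μ n = 0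
      have h3 : descProd μ (n + 1) = -(μ + n) * descProd μ n := rfl
      have h4 : descProd μ (n + 1) * g.1 z.1 = -(∑ j ∈ Finset.range n,
          (a j).1 z.1 * descProd μ j * coordFun k k z.1 ^ (n - j) +
            (a n).1 z.1 * descProd μ n) := by
        rw [h2]
        field_simp
      linear_combination h4 - g.1 z.1 * h3
    have h2 := add_mem h1 (Ideal.mul_mem_left _ (mulHom V g)
      (coord_mul_pow_add_mem_genH hk V μ n))
    have hsum : ∑ j ∈ Finset.range n, mulHom V (a' j) * pdR V k ^ j =
        ∑ j ∈ Finset.range n, mulHom V (a j) * pdR V k ^ j :=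
      Finset.sum_congr rfl fun j hj => by rw [hne j hj]
    convert h2 using 1
    rw [Finset.sum_range_succ, Finset.sum_range_succ, Finset.sum_range_succ, hlast, hsum, hn,
      map_sub, mul_comm _ g, map_mul (mulHom V) g, constR, diffRes_const]
    noncomm_ring

/-- If `t Σ_n (Q c_n) t^n + Σ_n (v c_n) t^n`, with `c_n` the coefficients of
`(1 + σ_1 t + ⋯ + σ_k t^k)^(-μ)`, is a monomial in `t`, then `Q` belongs to `H_μ`. -/
theorem mem_genH_of_traceValue {k : ℕ} (hk : 0 < k) {V : Opens (N k)} {μ : ℂ}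
    (hμ : ∀ n : ℤ, μ ≠ n) {Q v : DiffOp V} (hQ : Q ∈ genSub V) (hv : v ∈ genSub V) (l : ℕ)
    (h : ∀ (z : V) (n : ℕ), n ≠ l → traceValue μ z (n - 1) Q + traceValue μ z n v = 0) :
    Q ∈ spanR V (genH k μ) := by
  obtain ⟨f, hf⟩ := exists_normalForm μ hQ
  obtain ⟨g, hg⟩ := exists_normalForm μ hv
  have hf' : ∀ z n, traceValue μ z n Q = traceValue μ z n (monomialSum V f) := fun z n => by
    rw [← sub_eq_zero, ← map_sub, traceValue_eq_zero_of_mem_spanR hf]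
  have hg' : ∀ z n, traceValue μ z n v = traceValue μ z n (monomialSum V g) := fun z n => by
    rw [← sub_eq_zero, ← map_sub, traceValue_eq_zero_of_mem_spanR hg]
  obtain ⟨n, hn⟩ : ∃ n, ∀ m ∈ f.support ∪ g.support, m ≤ n :=
    ⟨(f.support ∪ g.support).sup id, fun m hm => Finset.le_sup (f := id) hm⟩
  have hfn : ∀ m ∈ f.support, m ≤ k * n := fun m hm =>
    (hn m (Finset.mem_union_left _ hm)).trans (Nat.le_mul_of_pos_left n hk)
  have hgn : ∀ m ∈ g.support, m ≤ k * n := fun m hm =>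
    (hn m (Finset.mem_union_right _ hm)).trans (Nat.le_mul_of_pos_left n hk)
  -- The bound `n` is common to `f` and `g`, so one power S^(-μ-n) serves both series.
  have hμn : ∀ i : ℤ, -(μ + n) ≠ i := fun i hi =>
    hμ (-i - n) (by push_cast; linear_combination -hi)
  let s : V → ℂ := fun z =>
    traceValue μ z (l - 1) (monomialSum V f) + traceValue μ z l (monomialSum V g)
  let α : V → Polynomial ℂ := fun z =>
    Polynomial.X * numerator μ n f z.1 + numerator μ n g z.1
  have hα : ∀ z : V, (α z : PowerSeries ℂ) * traceSeries k (μ + n) z.1 =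
      PowerSeries.C (s z) * PowerSeries.X ^ l := by
    intro z
    rw [Polynomial.coe_add, Polynomial.coe_mul, Polynomial.coe_X, add_mul, mul_assoc,
      ← mk_traceValue_monomialSum hk μ f hfn, ← mk_traceValue_monomialSum hk μ g hgn]
    ext i
    have h1 : PowerSeries.coeff i (PowerSeries.X *
        PowerSeries.mk fun i : ℕ => traceValue μ z i (monomialSum V f)) =
        traceValue μ z (i - 1) (monomialSum V f) := by
      cases i with
      | zero =>
        have h2 : traceFun V μ (-1) = (0 : holo V) :=
          holo_ext fun w => traceCoeff_of_neg (by norm_num) w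
        rw [PowerSeries.coeff_zero_X_mul, Nat.cast_zero, zero_sub, traceValue_apply, h2, map_zero,
          map_zero, map_zero]
      | succ i => rw [PowerSeries.coeff_succ_X_mul, PowerSeries.coeff_mk]; simp
    rw [map_add, h1, PowerSeries.coeff_mk, PowerSeries.coeff_C_mul, PowerSeries.coeff_X_pow]
    by_cases hi : i = l
    · rw [if_pos hi, mul_one, hi]
    · rw [if_neg hi, mul_zero, ← hf', ← hg', h z i hi]
  have hα' : ∀ z : V, (α z : PowerSeries ℂ) =
      PowerSeries.C (s z) * (PowerSeries.X ^ l * traceSeries k (-(μ + n)) z.1) := by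
    intro z
    rw [← mul_assoc, ← hα, mul_assoc, traceSeries_mul_traceSeries_neg, mul_one]
  have hdegf : ∀ z : V, (numerator μ n f z.1).natDegree ≤ k * n := fun z =>
    natDegree_numerator_le hk μ n f z.1
  have hdegg : ∀ z : V, (numerator μ n g z.1).natDegree ≤ k * n := fun z =>
    natDegree_numerator_le hk μ n g z.1
  -- `α z` has degree at most k n + 1, so its coefficient in degree k n + 2 + l is zero.
  have hs0 : ∀ z : V, s z * traceCoeff k (-(μ + n)) (k * n + 2 : ℕ) z.1 = 0 := by
    intro z
    have h1 := congrArg (PowerSeries.coeff (k * n + 2 + l)) (hα' z)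
    rw [Polynomial.coeff_coe, PowerSeries.coeff_C_mul, PowerSeries.coeff_X_pow_mul, traceSeries,
      PowerSeries.coeff_mk, Polynomial.coeff_add, show k * n + 2 + l = k * n + 1 + l + 1 by omega,
      Polynomial.coeff_X_mul, Polynomial.coeff_eq_zero_of_natDegree_lt ((hdegf z).trans_lt (by omega)),
      Polynomial.coeff_eq_zero_of_natDegree_lt ((hdegg z).trans_lt (by omega)), add_zero] at h1
    exact h1.symm
  -- If `s` were nonzero at a point, it would be so nearby by continuity, and a coefficient of a
  -- nonintegral power of S would vanish on an open set.
  have hs : ∀ z : V, s z = 0 := by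
    intro z
    by_contra hz
    have hcont : Continuous s := (continuous_traceValue_monomialSum hk μ _ f).add
      (continuous_traceValue_monomialSum hk μ _ g)
    have h1 : ∀ᶠ w in 𝓝 z, traceCoeff k (-(μ + n)) (k * n + 2 : ℕ) w.1 = 0 := by
      filter_upwards [hcont.continuousAt.eventually_ne hz] with w hw
      exact (mul_eq_zero.1 (hs0 w)).resolve_left hw
    refine not_eventually_traceCoeff_eq_zero hk hμn (k * n + 2) z.1 ?_
    have h2 := V.isOpen.isOpenEmbedding_subtypeVal.map_nhds_eq z
    rw [← h2]
    exact h1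
  have hcoeff : ∀ z : V, ∑ j ∈ Finset.range (n + 1),
      (f (k * j)).1 z.1 * descProd μ j * coordFun k k z.1 ^ (n - j) = 0 := by
    intro z
    have h1 := hα' z
    rw [hs, map_zero, zero_mul] at h1
    -- In degree k n + 1 only t times the numerator of `f` can contribute, which isolates its top
    -- coefficient.
    have h2 := congrArg (PowerSeries.coeff (k * n + 1)) h1
    rw [Polynomial.coeff_coe, Polynomial.coeff_add, Polynomial.coeff_X_mul,
      Polynomial.coeff_eq_zero_of_natDegree_lt ((hdegg z).trans_lt (Nat.lt_succ_self _)), add_zero,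
      map_zero, coeff_numerator hk] at h2
    exact h2
  have h1 := sum_mul_pow_mem_genH hk hμ n (fun j => f (k * j)) hcoeff
  -- Modulo H_μ only the pure powers of ∂_k remain.
  have h2 : monomialSum V f - ∑ j ∈ Finset.range (n + 1), mulHom V (f (k * j)) * pdR V k ^ j ∈
      spanR V (genH k μ) := by
    have h3 : ∑ j ∈ Finset.range (n + 1), mulHom V (f (k * j)) * pdR V k ^ j =
        ∑ m ∈ (Finset.range (n + 1)).image (k * ·), mulHom V (f m) * monomialR V m := by
      rw [Finset.sum_image fun a _ b _ h => Nat.eq_of_mul_eq_mul_left hk h]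
      exact Finset.sum_congr rfl fun j _ => by rw [monomialR_mul V hk]
    have h4 : monomialSum V f =
        ∑ m ∈ Finset.range (k * n + 1), mulHom V (f m) * monomialR V m := by
      rw [monomialSum_apply]
      refine Finset.sum_subset (fun m hm => Finset.mem_range.2 (Nat.lt_succ_of_le (hfn m hm)))
        fun m _ hm => ?_
      rw [Finsupp.notMem_support_iff.1 hm, map_zero, zero_mul]
    have hsub : (Finset.range (n + 1)).image (k * ·) ⊆ Finset.range (k * n + 1) := by
      intro m hm
      obtain ⟨j, hj, rfl⟩ := Finset.mem_image.1 hm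
      rw [Finset.mem_range] at hj ⊢
      exact Nat.lt_succ_of_le (Nat.mul_le_mul_left k (by omega))
    rw [h3, h4, ← Finset.sum_sdiff hsub, add_sub_cancel_right]
    refine sum_mem fun m hm => Ideal.mul_mem_left _ _ (monomialR_mem_genH hk ?_)
    rintro ⟨j, rfl⟩
    rw [Finset.mem_sdiff, Finset.mem_range] at hm
    refine hm.2 (Finset.mem_image.2 ⟨j, Finset.mem_range.2 ?_, rfl⟩)
    exact Nat.lt_succ_of_le (Nat.le_of_mul_le_mul_left (by omega) hk)
  have h5 := add_mem (genI_le_genH hf) (add_mem h2 h1)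
  rwa [sub_add_cancel, sub_add_cancel] at h5

theorem mem_localIdeal_of_mul_Um1 {k : ℕ} (hk : 0 < k) {μ : ℂ} (hμ : ∀ n : ℤ, μ ≠ n)
    (U : Opens (N k)) (Q : DiffOp U)
    (h : Q * diffRes le_top (Um1 k) ∈ localIdeal (genJ k μ (1 - k * μ)) U) :
    Q ∈ localIdeal (genH k μ) U := by
  intro z
  obtain ⟨V, hV, i, v, hQ, hv, hI⟩ := exists_mul_sub_mem h z
  refine ⟨V, hV, i, ?_⟩
  have key : ∀ (z : V) (n : ℤ),
      (n - 1 + k * μ) * (traceValue μ z (n - 1) (diffRes i Q) + traceValue μ z n v) = 0 := by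
    intro z n
    have h1 := traceValue_eq_zero_of_mem_spanR hI z n
    rw [map_sub, traceValue_mul_Um1R, mul_sub, map_sub, traceValue_mul_U0R,
      traceValue_mul_constR] at h1
    linear_combination -h1
  -- At most one natural number equals 1 - kμ, and there the factor cannot be cancelled. If there is
  -- none, the choice `l = 0` is arbitrary.
  obtain ⟨l, hl⟩ : ∃ l : ℕ, ∀ n : ℕ, n ≠ l → (n : ℂ) - 1 + k * μ ≠ 0 := by
    by_cases hl : ∃ l : ℕ, (l : ℂ) - 1 + k * μ = 0
    · obtain ⟨l, hl⟩ := hl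
      exact ⟨l, fun n hn h => hn (by exact_mod_cast (by linear_combination h - hl : (n : ℂ) = l))⟩
    · exact ⟨0, fun n _ h => hl ⟨n, h⟩⟩
  refine mem_genH_of_traceValue hk hμ hQ hv l fun z n hn => ?_
  have h1 := key z n
  rw [Int.cast_natCast] at h1
  exact (mul_eq_zero.1 h1).resolve_left (hl n hn)

end MuTrace

end

/-- Here `χ : K_μ ⟶ N_{μ,1-kμ}`, the map `G : N_{μ,1-kμ} ⟶ N_{μ,-kμ}` is the right multiplication by
`U_1 + μ σ_1`, and `F : N_{μ,-kμ} ⟶ N_{μ,1-kμ}` is the right multiplication by `U_{-1}`. -/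
theorem proposition5p2p1 (k : ℕ) (hk : 1 ≤ k) (μ : ℂ) (hμ : ∀ n : ℤ, μ ≠ n)
    (hkμ : (k : ℂ) * μ ≠ 1) :
    ∃ (χ : MuTrace.K k μ ⟶ MuTrace.NMod k μ (1 - k * μ))
      (G : MuTrace.NMod k μ (1 - k * μ) ⟶ MuTrace.NMod k μ (-(k * μ)))
      (F : MuTrace.NMod k μ (-(k * μ)) ⟶ MuTrace.NMod k μ (1 - k * μ)),
      Mono χ ∧
      χ.val.app (op ⊤) (MuTrace.cls (MuTrace.genH k μ) 1) =
        MuTrace.cls (MuTrace.genJ k μ (1 - k * μ)) (MuTrace.Um1 k) ∧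
      MuTrace.IsRightMul (MuTrace.U1μ k μ) G ∧
      MuTrace.IsRightMul (MuTrace.Um1 k) F ∧
      (∃ e : cokernel χ ≅ (MuTrace.Nsharp k μ : SheafOfModules (MuTrace.D k)),
        cokernel.π χ ≫ e.hom ≫ (MuTrace.Nsharp k μ).arrow = G) ∧
      MuTrace.Nsharp k μ = kernelSubobject F := by

  have hk' : 0 < k := hk
  refine MuTrace.complex_of_localIdeal (SH := MuTrace.genH k μ)
    (SJ := MuTrace.genJ k μ (1 - k * μ)) (SJ' := MuTrace.genJ k μ (-(k * μ)))
    (W := MuTrace.Um1 k) (Y := MuTrace.U1μ k μ) ?_ ?_ ?_ ?_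
    (MuTrace.mem_localIdeal_of_mul_Um1 hk' hμ) (MuTrace.mem_localIdeal_of_mul_U1μ hk' hμ hkμ) ?_ ?_
  · rintro _ (⟨h, h1, hhk, rfl⟩ | rfl)
    · exact MuTrace.mem_localIdeal_of_mem_span (MuTrace.pdR_mul_Um1R_mem (V := ⊤) hμ h1 hhk)
    · exact MuTrace.mem_localIdeal_of_mem_span (MuTrace.eulerR_mul_Um1R_mem (V := ⊤) hk' hμ)
  · rintro s (hs | rfl)
    · exact MuTrace.mem_localIdeal_of_mem_span (MuTrace.mul_U1μR_mem_of_mem_genI (V := ⊤) hk' hμ _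
        (MuTrace.genI_subset_genSub hs) (MuTrace.diffRes_mem_spanR ⊤ hs))
    · exact MuTrace.mem_localIdeal_of_mem_span (MuTrace.U0R_sub_mul_U1μR_mem (V := ⊤) hk' hμ)
  · rintro s (hs | rfl)
    · exact MuTrace.mem_localIdeal_of_mem_span (MuTrace.mul_Um1R_mem_of_mem_genI (V := ⊤) hk' hμ _
        (MuTrace.genI_subset_genSub hs) (MuTrace.diffRes_mem_spanR ⊤ hs))
    · exact MuTrace.mem_localIdeal_of_mem_span (MuTrace.U0R_sub_mul_Um1R_mem (V := ⊤) hk' hμ)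
  · exact MuTrace.mem_localIdeal_of_mem_span (MuTrace.Um1R_mul_U1μR_mem (V := ⊤) hk' hμ)
  · exact MuTrace.mem_localIdeal_of_mem_span (MuTrace.U1μR_mem_genH (V := ⊤))
  · rintro _ (⟨h, h1, hhk, rfl⟩ | rfl)
    · exact MuTrace.mem_localIdeal_of_mem_span (MuTrace.pdR_mem_genJ_union (V := ⊤) hμ hkμ h1 hhk)
    · exact MuTrace.mem_localIdeal_of_mem_span (MuTrace.eulerR_mem_genJ_union (V := ⊤) hk' hμ hkμ)
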